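/- Let $1<p<\infty$ and $1/p-1<\gamma<1/p$. Let $\{\lambda_n\}_{n\ge1}$ be a sequence in the class GBV, that is, $\lambda_n\ge0$ for all $n\ge1$, $\lambda_n\to0$, and there is a constant $M>0$, depending only on the sequence, such that $$\sum_{n=m}^{2m}|\lambda_n-\lambda_{n+1}|\le M\lambda_m\qquad\text{for all } m\ge1 .$$ Consider either the cosine series $\lambda_0+\sum_{n\ge1}\lambda_n\cos nx$ (with an arbitrary real $\lambda_0$) or the sine series $\sum_{n\ge1}\lambda_n\sin nx$. (i) If $\varphi$ is a $2\pi$-periodic real function, integrable over a period, whose Fourier series is this series, then $$x^{-\gamma}\varphi(x)\in L^p(0,\pi)\quad\Longleftrightarrow\quad\sum_{n=1}^{\infty}n^{p+p\gamma-2}\lambda_n^p<\infty .$$ (ii) If $\sum_{n=1}^{\infty}n^{p+p\gamma-2}\lambda_n^p<\infty$, then the series converges at every $x\notin 2\pi\mathbb Z$, and its sum is (almost everywhere) a function $\varphi$ as in (i); in particular $x^{-\gamma}\varphi(x)\in L^p(0,\pi)$. -/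

import Mathlib

open MeasureTheory Filter Topology

/-- The class GBV: sequences `c 1, c 2, …` of nonnegative reals tending to zero such that
`∑_{n=m}^{2m} |c n - c (n+1)| ≤ M * c m` for all `m ≥ 1`, with `M > 0` depending only on the
sequence. Nothing is required of the entry `c 0`. -/
def GBV (c : ℕ → ℝ) : Prop :=
  (∀ n : ℕ, 1 ≤ n → 0 ≤ c n) ∧ Tendsto c atTop (𝓝 0) ∧
    ∃ M : ℝ, 0 < M ∧ ∀ m : ℕ, 1 ≤ m →
      ∑ n ∈ Finset.Icc m (2 * m), |c n - c (n + 1)| ≤ M * c m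

/-- `φ` is a `2π`-periodic function, integrable over a period, whose Fourier series is
`∑_{n ≥ 0} (a n * cos (n x) + b n * sin (n x))`. The value `b 0` is irrelevant. -/
structure HasTrigFourierSeries (φ : ℝ → ℝ) (a b : ℕ → ℝ) : Prop where
  periodic : Function.Periodic φ (2 * Real.pi)
  integrable : IntegrableOn φ (Set.Ioc (-Real.pi) Real.pi) volume
  coeff_zero : (1 / (2 * Real.pi)) * ∫ x in (-Real.pi)..Real.pi, φ x = a 0
  coeff_cos : ∀ n : ℕ, 1 ≤ n →
    (1 / Real.pi) * ∫ x in (-Real.pi)..Real.pi, φ x * Real.cos (n * x) = a n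
  coeff_sin : ∀ n : ℕ, 1 ≤ n →
    (1 / Real.pi) * ∫ x in (-Real.pi)..Real.pi, φ x * Real.sin (n * x) = b n

/-- The trigonometric series `∑_{n ≥ 0} (a n * cos (n x) + b n * sin (n x))` converges at the
point `x` to the number `s`, in the sense of its sequence of partial sums. -/
def TrigSeriesConvergesTo (a b : ℕ → ℝ) (x s : ℝ) : Prop :=
  Tendsto (fun N : ℕ => ∑ n ∈ Finset.range N, (a n * Real.cos (n * x) + b n * Real.sin (n * x)))
    atTop (𝓝 s)

/-- `x ^ (-γ) * φ x` belongs to `L^p` on `(0, π)`. -/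
def WeightedMemLp (p γ : ℝ) (φ : ℝ → ℝ) : Prop :=
  MemLp (fun x : ℝ => x ^ (-γ) * φ x) (ENNReal.ofReal p)
    (volume.restrict (Set.Ioo 0 Real.pi))

/-! Everything is measured on dyadic scales. Put α = 1 + γ - 1/p; the hypotheses on γ say exactly
that 0 < α < 1. GBV bounds c n by (1 + M) c m for m ≤ n ≤ 2m + 1 (`le_of_doubling_variation`), so
condensation turns the weighted sum into ∑ (2^(iα) c(2^i))^p, because p + pγ - 1 = pα
(`summable_weighted_iff_dyadic`).

Both directions rest on the kernel 2^min(i,j). It is at most 2^(j(1-α)) r^|i-j| 2^(iα) with r < 1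
(`two_pow_min_le`), and convolution with r^|k| is bounded on ℓ^p by the Schur test
(`summable_geometric_conv`).

From coefficients to function: for |x| of size π/2^j, the terms with n < 2^j are estimated trivially
and the rest by Abel summation. All partial sums are then O(∑ 2^min(i,j) c(2^i)), up to a term for c
0 (`norm_partial_sum_le`), hence at most 2^(j(1-α)) E j with E in ℓ^p. This bound gives an
integrable majorant, so the sum has the right Fourier coefficients, and it gives the weighted L^p
norm.

From function to coefficients: with N = 2^j, z = e^(ix) and D = ∑_{k<N} z^k, pairing φ with the real
or imaginary part of z^N D² yields π ∑_{k,l<N} c(N+k+l), which dominates a multiple of N² c(4N).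
Since |D| ≤ 2·2^min(i,j) at scale i, the pairing is O(N ∑ 2^min(i,j) ∫|φ|), the integrals being over
the dyadic intervals (`HasTrigFourierSeries.coeff_le`). Hölder places these integrals, weighted by
2^(iα), in ℓ^p (`WeightedMemLp.summable_dyadic`).

Uniqueness of Fourier coefficients transfers the result from the constructed sum to an arbitrary φ.
-/

/-! ### Schur test and geometric convolution on ℓ^p -/

/-- Schur test: a kernel with bounded row and column sums acts boundedly on `ℓ^p`. -/
theorem ENNReal.tsum_kernel_rpow_le (w : ℕ → ℕ → ENNReal) (S : ENNReal) (B : ℕ → ENNReal)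
    (hrow : ∀ j, ∑' i, w i j ≤ S) (hcol : ∀ i, ∑' j, w i j ≤ S) {p : ℝ} (hp : 1 < p) :
    ∑' j, (∑' i, w i j * B i) ^ p ≤ S ^ p * ∑' i, B i ^ p := by
  have hp0 : 0 < p := by linarith
  have hpq : p.HolderConjugate p.conjExponent := Real.HolderConjugate.conjExponent hp
  set q := p.conjExponent
  have hq0 : 0 < q := hpq.symm.pos
  have holder : ∀ j, (∑' i, w i j * B i) ^ p ≤ S ^ (p - 1) * ∑' i, w i j * B i ^ p := by
    intro j
    -- Hölder for counting measure with w = w^(1/p) · w^(1/q): one factor keeps w B^p, the other is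
    -- a power of the row sum.
    have h := ENNReal.lintegral_mul_le_Lp_mul_Lq (μ := Measure.count (α := ℕ)) hpq
      (f := fun i => w i j ^ (1 / p) * B i) (g := fun i => w i j ^ (1 / q))
      (Measurable.aemeasurable (measurable_of_countable _))
      (Measurable.aemeasurable (measurable_of_countable _))
    simp only [lintegral_count, Pi.mul_apply] at h
    have e1 : ∀ i, w i j ^ (1 / p) * B i * w i j ^ (1 / q) = w i j * B i := by
      intro i
      have : w i j ^ (1 / p) * w i j ^ (1 / q) = w i j := by
        rw [← ENNReal.rpow_add_of_nonneg _ _ (by positivity) (by positivity)]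
        have := hpq.inv_add_inv_eq_one
        rw [one_div, one_div, this, ENNReal.rpow_one]
      calc _ = (w i j ^ (1 / p) * w i j ^ (1 / q)) * B i := by ring
        _ = _ := by rw [this]
    have e2 : ∀ i, (w i j ^ (1 / p) * B i) ^ p = w i j * B i ^ p := by
      intro i
      rw [ENNReal.mul_rpow_of_nonneg _ _ hp0.le, ← ENNReal.rpow_mul, one_div_mul_cancel hp0.ne',
        ENNReal.rpow_one]
    have e3 : ∀ i, (w i j ^ (1 / q)) ^ q = w i j := by
      intro i
      rw [← ENNReal.rpow_mul, one_div_mul_cancel hq0.ne', ENNReal.rpow_one]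
    simp only [e1, e2, e3] at h
    calc (∑' i, w i j * B i) ^ p
        ≤ ((∑' i, w i j * B i ^ p) ^ (1 / p) * (∑' i, w i j) ^ (1 / q)) ^ p :=
          ENNReal.rpow_le_rpow h hp0.le
      _ = (∑' i, w i j * B i ^ p) * (∑' i, w i j) ^ (p - 1) := by
          rw [ENNReal.mul_rpow_of_nonneg _ _ hp0.le, ← ENNReal.rpow_mul, ← ENNReal.rpow_mul,
            one_div_mul_cancel hp0.ne', ENNReal.rpow_one,
            show 1 / q * p = p - 1 from by
              have := hpq.inv_add_inv_eq_one
              rw [one_div, show q⁻¹ = 1 - p⁻¹ by linarith, sub_mul, inv_mul_cancel₀ hp0.ne', one_mul]]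
      _ ≤ (∑' i, w i j * B i ^ p) * S ^ (p - 1) := by
          gcongr
          exact hrow j
      _ = _ := mul_comm _ _
  calc ∑' j, (∑' i, w i j * B i) ^ p ≤ ∑' j, S ^ (p - 1) * ∑' i, w i j * B i ^ p :=
        ENNReal.tsum_le_tsum holder
    _ = S ^ (p - 1) * ∑' i, (∑' j, w i j) * B i ^ p := by
        rw [ENNReal.tsum_mul_left, ENNReal.tsum_comm]
        simp only [ENNReal.tsum_mul_right]
    _ ≤ S ^ (p - 1) * ∑' i, S * B i ^ p := by
        gcongr with i
        exact hcol i
    _ = S ^ p * ∑' i, B i ^ p := by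
        rw [ENNReal.tsum_mul_left, ← mul_assoc]
        congr 1
        nth_rewrite 2 [← ENNReal.rpow_one S]
        rw [← ENNReal.rpow_add_of_nonneg _ _ (by linarith) zero_le_one, sub_add_cancel]

theorem summable_pow_natAbs {r : ℝ} (h0 : 0 ≤ r) (h1 : r < 1) :
    Summable fun k : ℤ => r ^ k.natAbs := by
  refine Summable.of_nat_of_neg ?_ ?_ <;> simpa using summable_geometric_of_lt_one h0 h1

/-- Convolution with the two-sided geometric kernel is bounded on `ℓ^p`. -/
theorem summable_geometric_conv {r : ℝ} (h0 : 0 ≤ r) (h1 : r < 1) {p : ℝ} (hp : 1 < p)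
    {B : ℕ → ℝ} (hB : ∀ i, 0 ≤ B i) (hs : Summable fun i => B i ^ p) :
    (∀ j : ℕ, Summable fun i : ℕ => r ^ ((i : ℤ) - j).natAbs * B i) ∧
      Summable fun j : ℕ => (∑' i : ℕ, r ^ ((i : ℤ) - j).natAbs * B i) ^ p := by
  have hp0 : 0 < p := by linarith
  set w : ℕ → ℕ → ENNReal := fun i j => ENNReal.ofReal (r ^ ((i : ℤ) - j).natAbs) with hw
  set S : ENNReal := ∑' k : ℤ, ENNReal.ofReal (r ^ k.natAbs) with hS
  have hSt : S ≠ ⊤ := (summable_pow_natAbs h0 h1).tsum_ofReal_ne_top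
  -- Rows and columns are injective copies of ℕ inside ℤ, so the two-sided sum S bounds both.
  have hrow : ∀ j, ∑' i, w i j ≤ S := fun j =>
    ENNReal.tsum_comp_le_tsum_of_injective (f := fun i : ℕ => (i : ℤ) - j)
      (fun a b h => by simpa using h) (fun k : ℤ => ENNReal.ofReal (r ^ k.natAbs))
  have hcol : ∀ i, ∑' j, w i j ≤ S := fun i =>
    ENNReal.tsum_comp_le_tsum_of_injective (f := fun j : ℕ => (i : ℤ) - j)
      (fun a b h => by simpa using h) (fun k : ℤ => ENNReal.ofReal (r ^ k.natAbs))
  have key := ENNReal.tsum_kernel_rpow_le w S (fun i => ENNReal.ofReal (B i)) hrow hcol hp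
  have hfin : S ^ p * ∑' i, ENNReal.ofReal (B i) ^ p ≠ ⊤ := by
    refine ENNReal.mul_ne_top (ENNReal.rpow_ne_top_of_nonneg hp0.le hSt) ?_
    simp only [ENNReal.ofReal_rpow_of_nonneg (hB _) hp0.le]
    exact hs.tsum_ofReal_ne_top
  have hfin' := ne_top_of_le_ne_top hfin key
  have e : ∀ i j, w i j * ENNReal.ofReal (B i)
      = ENNReal.ofReal (r ^ ((i : ℤ) - j).natAbs * B i) := fun i j => by
    rw [hw, ENNReal.ofReal_mul (by positivity)]
  simp only [e] at hfin'
  have hnn : ∀ i j : ℕ, 0 ≤ r ^ ((i : ℤ) - j).natAbs * B i := fun i j =>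
    mul_nonneg (by positivity) (hB i)
  have hsum : ∀ j : ℕ, Summable fun i : ℕ => r ^ ((i : ℤ) - j).natAbs * B i := by
    intro j
    have h := ENNReal.ne_top_of_tsum_ne_top hfin' j
    have h' : ∑' i : ℕ, ENNReal.ofReal (r ^ ((i : ℤ) - j).natAbs * B i) ≠ ⊤ := by
      intro hh
      rw [hh, ENNReal.top_rpow_of_pos hp0] at h
      exact h rfl
    have := ENNReal.summable_toReal h'
    simpa only [ENNReal.toReal_ofReal (hnn _ _)] using this
  refine ⟨hsum, ?_⟩
  have := ENNReal.summable_toReal hfin'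
  refine this.congr fun j => ?_
  rw [← ENNReal.ofReal_tsum_of_nonneg (fun i => hnn i j) (hsum j), ← ENNReal.toReal_rpow,
    ENNReal.toReal_ofReal (tsum_nonneg fun i => hnn i j)]

/-! ### Uniqueness of Fourier coefficients -/

/-- An integrable function on `(-π, π)` all of whose trigonometric moments vanish is zero. -/
theorem ae_eq_zero_of_trig_moments_eq_zero {f : ℝ → ℝ}
    (hf : IntegrableOn f (Set.Ioc (-Real.pi) Real.pi))
    (hcos : ∀ n : ℕ, ∫ x in (-Real.pi)..Real.pi, f x * Real.cos (n * x) = 0)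
    (hsin : ∀ n : ℕ, ∫ x in (-Real.pi)..Real.pi, f x * Real.sin (n * x) = 0) :
    ∀ᵐ x, x ∈ Set.Ioo (-Real.pi) Real.pi → f x = 0 := by
  have hpi := Real.pi_pos
  have hle : -Real.pi ≤ Real.pi := by linarith
  have : Fact (0 < 2 * Real.pi) := ⟨by positivity⟩
  let μ : Measure ℝ := volume.restrict (Set.Ioc (-Real.pi) Real.pi)
  have hfμ : Integrable f μ := hf
  have hfC : Integrable (fun x => (f x : ℂ)) μ := hfμ.ofReal
  have hint : ∀ g : C(AddCircle (2 * Real.pi), ℂ),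
      Integrable (fun x : ℝ => (f x : ℂ) * g (x : AddCircle (2 * Real.pi))) μ := by
    intro g
    refine hfC.mul_bdd (c := ‖g‖) ?_ ?_
    · exact (g.continuous.comp (AddCircle.continuous_mk' _)).aestronglyMeasurable
    · exact Eventually.of_forall fun x => g.norm_coe_le_norm _
  have hclosed : ∀ g : C(AddCircle (2 * Real.pi), ℂ),
      ∫ x, (f x : ℂ) * g (x : AddCircle (2 * Real.pi)) ∂μ = 0 := by
    have hfour : ∀ n : ℤ, ∫ x, (f x : ℂ) * fourier n (x : AddCircle (2 * Real.pi)) ∂μ = 0 := by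
      have hcosμ : ∀ n : ℤ, ∫ x, f x * Real.cos (n * x) ∂μ = 0 := by
        intro n
        have := hcos n.natAbs
        rw [intervalIntegral.integral_of_le hle] at this
        rw [← this]
        refine integral_congr_ae (Eventually.of_forall fun x => ?_)
        rcases Int.natAbs_eq n with h | h <;> rw [h] <;> simp
      have hsinμ : ∀ n : ℤ, ∫ x, f x * Real.sin (n * x) ∂μ = 0 := by
        intro n
        have := hsin n.natAbs
        rw [intervalIntegral.integral_of_le hle] at this
        rcases Int.natAbs_eq n with h | h
        · rw [← this]
          refine integral_congr_ae (Eventually.of_forall fun x => ?_)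
          rw [h]; simp
        · rw [← neg_eq_zero, ← integral_neg, ← this]
          refine integral_congr_ae (Eventually.of_forall fun x => ?_)
          rw [h]; simp
      intro n
      have e : ∀ x : ℝ, (f x : ℂ) * fourier n (x : AddCircle (2 * Real.pi))
          = ((f x * Real.cos (n * x) : ℝ) : ℂ) + ((f x * Real.sin (n * x) : ℝ) : ℂ) * Complex.I := by
        intro x
        rw [fourier_coe_apply]
        have : 2 * (Real.pi : ℂ) * Complex.I * n * x / ((2 * Real.pi : ℝ) : ℂ)
            = ((n * x : ℝ) : ℂ) * Complex.I := by
          have : (Real.pi : ℂ) ≠ 0 := by exact_mod_cast hpi.ne'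
          push_cast
          field_simp
        rw [this, Complex.exp_mul_I]
        push_cast
        ring
      have hic : Integrable (fun x => ((f x * Real.cos (n * x) : ℝ) : ℂ)) μ := by
        refine (hfμ.mul_bdd (c := 1) ?_ ?_).ofReal
        · exact (by fun_prop : Continuous fun x : ℝ => Real.cos (n * x)).aestronglyMeasurable
        · exact Eventually.of_forall fun x => Real.abs_cos_le_one _
      have his : Integrable (fun x => ((f x * Real.sin (n * x) : ℝ) : ℂ) * Complex.I) μ := by
        refine (Integrable.ofReal (hfμ.mul_bdd (c := 1) ?_ ?_)).mul_const _
        · exact (by fun_prop : Continuous fun x : ℝ => Real.sin (n * x)).aestronglyMeasurable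
        · exact Eventually.of_forall fun x => Real.abs_sin_le_one _
      simp_rw [e]
      rw [integral_add hic his, integral_mul_const, integral_complex_ofReal, integral_complex_ofReal, hcosμ, hsinμ]
      simp
    have hspan : ∀ g ∈ Submodule.span ℂ (Set.range (fourier (T := 2 * Real.pi))),
        ∫ x, (f x : ℂ) * g (x : AddCircle (2 * Real.pi)) ∂μ = 0 := by
      intro g hg
      induction hg using Submodule.span_induction with
      | mem g hg =>
        obtain ⟨n, rfl⟩ := hg
        exact hfour n
      | zero => simp
      | add g h _ _ hg hh =>
        simp only [ContinuousMap.add_apply, mul_add]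
        rw [integral_add (hint g) (hint h), hg, hh, add_zero]
      | smul c g _ hg =>
        simp only [ContinuousMap.smul_apply, smul_eq_mul, mul_left_comm _ c]
        rw [integral_const_mul, hg, mul_zero]
    intro g
    -- Trigonometric polynomials are uniformly dense, and g ↦ ∫ f g is Lipschitz in the sup norm
    -- with constant ∫ |f|.
    have hgc : g ∈ closure (Submodule.span ℂ (Set.range (fourier (T := 2 * Real.pi))) :
        Set C(AddCircle (2 * Real.pi), ℂ)) := by
      have := (span_fourier_closure_eq_top (T := 2 * Real.pi))
      rw [← Submodule.topologicalClosure_coe, this]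
      trivial
    have hcont : Continuous fun g : C(AddCircle (2 * Real.pi), ℂ) =>
        ∫ x, (f x : ℂ) * g (x : AddCircle (2 * Real.pi)) ∂μ := by
      refine (LipschitzWith.of_dist_le_mul (K := (∫ x, ‖f x‖ ∂μ).toNNReal) fun g h => ?_).continuous
      rw [dist_eq_norm, ← integral_sub (hint g) (hint h), dist_eq_norm,
        Real.coe_toNNReal _ (integral_nonneg fun x => norm_nonneg _), ← integral_mul_const]
      refine norm_integral_le_of_norm_le (hfμ.norm.mul_const _)
        (Eventually.of_forall fun x => ?_)
      rw [← mul_sub, norm_mul, Complex.norm_real]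
      gcongr
      exact (g - h).norm_coe_le_norm _
    exact closure_minimal (s := (Submodule.span ℂ (Set.range (fourier (T := 2 * Real.pi))) :
        Set C(AddCircle (2 * Real.pi), ℂ))) (t := {g | _ = (0 : ℂ)})
      (fun g hg => hspan g hg) (isClosed_eq hcont continuous_const) hgc
  refine isOpen_Ioo.ae_eq_zero_of_integral_contDiff_smul_eq_zero
    ((hf.mono_set Set.Ioo_subset_Ioc_self).locallyIntegrableOn) fun g hg _ hgs => ?_
  have hg0 : ∀ x, x ∉ Set.Ioo (-Real.pi) Real.pi → g x = 0 := fun x hx =>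
    image_eq_zero_of_notMem_tsupport fun h => hx (hgs h)
  -- A test function supported in the open interval vanishes at both endpoints, so it descends to
  -- the circle.
  let G : C(AddCircle (2 * Real.pi), ℂ) :=
    ⟨AddCircle.liftIoc (2 * Real.pi) (-Real.pi) fun x => (g x : ℂ),
      AddCircle.liftIoc_continuous
        (by rw [hg0 _ (by simp), hg0 _ (by simp only [Set.mem_Ioo, not_and, not_lt]; intro; linarith)])
        (Complex.continuous_ofReal.comp hg.continuous).continuousOn⟩
  have h := hclosed G
  have e : ∫ x, (f x : ℂ) * G (x : AddCircle (2 * Real.pi)) ∂μ = ∫ x, ((g x • f x : ℝ) : ℂ) ∂μ := by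
    refine setIntegral_congr_fun measurableSet_Ioc fun x hx => ?_
    have : G (x : AddCircle (2 * Real.pi)) = (g x : ℂ) :=
      AddCircle.liftIoc_coe_apply (f := fun x => (g x : ℂ))
        (by rwa [show -Real.pi + 2 * Real.pi = Real.pi by ring])
    simp only [this, smul_eq_mul]
    push_cast
    ring
  rw [e, integral_complex_ofReal] at h
  rw [← setIntegral_eq_integral_of_forall_compl_eq_zero (s := Set.Ioc (-Real.pi) Real.pi)]
  · exact_mod_cast h
  · intro x hx
    rw [hg0 x fun h => hx (Set.Ioo_subset_Ioc_self h), zero_smul]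

/-! ### Dyadic condensation for GBV sequences -/

theorem sum_Ico_two_pow (f : ℕ → ℝ) (J : ℕ) :
    ∑ n ∈ Finset.Ico 1 (2 ^ J), f n
      = ∑ j ∈ Finset.range J, ∑ n ∈ Finset.Ico (2 ^ j) (2 ^ (j + 1)), f n := by
  induction J with
  | zero => simp
  | succ J ih =>
    rw [Finset.sum_range_succ, ← ih, Finset.sum_Ico_consecutive _ Nat.one_le_two_pow
      (Nat.pow_le_pow_right two_pos J.le_succ)]

/-- Cauchy condensation without monotonicity. GBV bounds only later terms by earlier ones, so a
block is compared from above with its own left endpoint and from below with the next one; hence the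
index j + 1. -/
theorem summable_iff_of_dyadic_blocks {f g : ℕ → ℝ} (hf : ∀ n, 1 ≤ n → 0 ≤ f n)
    (hg : ∀ j, 0 ≤ g j) {K : ℝ} (hK : 0 ≤ K)
    (hfg : ∀ j, ∑ n ∈ Finset.Ico (2 ^ j) (2 ^ (j + 1)), f n ≤ K * g j)
    (hgf : ∀ j, g (j + 1) ≤ K * ∑ n ∈ Finset.Ico (2 ^ j) (2 ^ (j + 1)), f n) :
    (Summable fun n => f (n + 1)) ↔ Summable g := by
  have shift : ∀ N, ∑ n ∈ Finset.range N, f (n + 1) = ∑ n ∈ Finset.Ico 1 (N + 1), f n := by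
    intro N
    rw [Finset.sum_Ico_eq_sum_range]
    simp [add_comm]
  constructor
  · intro h
    rw [← summable_nat_add_iff 1]
    refine summable_of_sum_range_le (c := K * ∑' n, f (n + 1)) (fun j => hg _) fun J => ?_
    calc ∑ j ∈ Finset.range J, g (j + 1)
        ≤ ∑ j ∈ Finset.range J, K * ∑ n ∈ Finset.Ico (2 ^ j) (2 ^ (j + 1)), f n :=
          Finset.sum_le_sum fun j _ => hgf j
      _ = K * ∑ n ∈ Finset.range (2 ^ J - 1), f (n + 1) := by
          rw [← Finset.mul_sum, ← sum_Ico_two_pow, shift, Nat.sub_add_cancel Nat.one_le_two_pow]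
      _ ≤ _ := by
          gcongr
          exact h.sum_le_tsum _ fun n _ => hf _ (by omega)
  · intro h
    refine summable_of_sum_range_le (c := K * ∑' j, g j) (fun n => hf _ (by omega)) fun N => ?_
    calc ∑ n ∈ Finset.range N, f (n + 1)
        ≤ ∑ n ∈ Finset.Ico 1 (2 ^ N), f n := by
          rw [shift]
          refine Finset.sum_le_sum_of_subset_of_nonneg
            (Finset.Ico_subset_Ico_right N.lt_two_pow_self) fun n hn _ => hf n ?_
          exact (Finset.mem_Ico.1 hn).1
      _ ≤ ∑ j ∈ Finset.range N, K * g j := by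
          rw [sum_Ico_two_pow]
          exact Finset.sum_le_sum fun j _ => hfg j
      _ ≤ _ := by
          rw [← Finset.mul_sum]
          gcongr
          exact h.sum_le_tsum _ fun n _ => hg _

theorem Real.rpow_le_two_rpow_abs_mul {x y : ℝ} (β : ℝ) (hx : 0 < x) (hxy : x ≤ y)
    (hyx : y ≤ 2 * x) : y ^ β ≤ 2 ^ |β| * x ^ β ∧ x ^ β ≤ 2 ^ |β| * y ^ β := by
  have hy : 0 < y := by linarith
  have h1 : 1 ≤ y / x := (one_le_div hx).2 hxy
  have h2 : y / x ≤ 2 := (div_le_iff₀ hx).2 hyx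
  have bound : ∀ δ : ℝ, (y / x) ^ δ ≤ 2 ^ |δ| := fun δ =>
    (Real.rpow_le_rpow_of_exponent_le h1 (le_abs_self δ)).trans
      (Real.rpow_le_rpow (by linarith) h2 (abs_nonneg δ))
  constructor
  · have := bound β
    rwa [Real.div_rpow hy.le hx.le, div_le_iff₀ (by positivity)] at this
  · have := bound (-β)
    rwa [abs_neg, Real.rpow_neg (by positivity), ← Real.inv_rpow (by positivity), inv_div,
      Real.div_rpow hx.le hy.le, div_le_iff₀ (by positivity)] at this

section GBV

variable {c : ℕ → ℝ} {M : ℝ}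

/-- The difference c n - c m telescopes over [m, n), which lies inside [m, 2m] as long as n ≤ 2m +
1. -/
theorem le_of_doubling_variation
    (hv : ∀ m : ℕ, 1 ≤ m → ∑ n ∈ Finset.Icc m (2 * m), |c n - c (n + 1)| ≤ M * c m)
    {m n : ℕ} (hm : 1 ≤ m) (hmn : m ≤ n) (hn : n ≤ 2 * m + 1) : c n ≤ (1 + M) * c m := by
  have h1 := dist_le_Ico_sum_dist c hmn
  simp only [Real.dist_eq] at h1
  have h2 : ∑ i ∈ Finset.Ico m n, |c i - c (i + 1)| ≤ M * c m := by
    refine (Finset.sum_le_sum_of_subset_of_nonneg ?_ fun i _ _ => abs_nonneg _).trans (hv m hm)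
    intro i hi
    rw [Finset.mem_Ico] at hi
    rw [Finset.mem_Icc]
    omega
  have h3 := neg_abs_le (c m - c n)
  linarith

theorem sum_dyadic_variation_le
    (hv : ∀ m : ℕ, 1 ≤ m → ∑ n ∈ Finset.Icc m (2 * m), |c n - c (n + 1)| ≤ M * c m)
    {j J : ℕ} (hjJ : j ≤ J) :
    ∑ n ∈ Finset.Ico (2 ^ j) (2 ^ J), |c n - c (n + 1)| ≤ M * ∑ i ∈ Finset.Ico j J, c (2 ^ i) := by
  induction J, hjJ using Nat.le_induction with
  | base => simp
  | succ J hJ ih =>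
    rw [Finset.sum_Ico_succ_top hJ, mul_add,
      ← Finset.sum_Ico_consecutive _ (Nat.pow_le_pow_right two_pos hJ)
        (Nat.pow_le_pow_right two_pos J.le_succ)]
    refine add_le_add ih
      ((Finset.sum_le_sum_of_subset_of_nonneg ?_ fun i _ _ => abs_nonneg _).trans
        (hv (2 ^ J) Nat.one_le_two_pow))
    intro i hi
    rw [Finset.mem_Ico, pow_succ] at hi
    rw [Finset.mem_Icc]
    omega

theorem summable_weighted_iff_dyadic (h0 : ∀ n : ℕ, 1 ≤ n → 0 ≤ c n) (hM : 0 < M)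
    (hv : ∀ m : ℕ, 1 ≤ m → ∑ n ∈ Finset.Icc m (2 * m), |c n - c (n + 1)| ≤ M * c m)
    {p : ℝ} (hp : 0 < p) (β : ℝ) :
    (Summable fun n : ℕ => ((n + 1 : ℕ) : ℝ) ^ β * c (n + 1) ^ p) ↔
      Summable fun j : ℕ => ((2 : ℝ) ^ j) ^ (β + 1) * c (2 ^ j) ^ p := by
  have hA : ∀ j : ℕ, 0 ≤ c (2 ^ j) := fun j => h0 _ Nat.one_le_two_pow
  have hmem : ∀ {j n : ℕ}, n ∈ Finset.Ico (2 ^ j) (2 ^ (j + 1)) →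
      2 ^ j ≤ n ∧ n < 2 * 2 ^ j ∧ 1 ≤ n := by
    intro j n hn
    rw [Finset.mem_Ico, pow_succ'] at hn
    exact ⟨hn.1, hn.2, Nat.one_le_two_pow.trans hn.1⟩
  have hcard : ∀ j : ℕ, ((Finset.Ico (2 ^ j) (2 ^ (j + 1))).card : ℝ) = 2 ^ j := by
    intro j
    rw [Nat.card_Ico, pow_succ, mul_two, Nat.add_sub_cancel]
    push_cast
    rfl
  have hpow : ∀ {j n : ℕ}, n ∈ Finset.Ico (2 ^ j) (2 ^ (j + 1)) →
      (n : ℝ) ^ β ≤ 2 ^ |β| * ((2 : ℝ) ^ j) ^ β ∧ ((2 : ℝ) ^ j) ^ β ≤ 2 ^ |β| * (n : ℝ) ^ β := by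
    intro j n hn
    obtain ⟨h1, h2, -⟩ := hmem hn
    refine Real.rpow_le_two_rpow_abs_mul β (by positivity) ?_ ?_
    · exact_mod_cast h1
    · exact_mod_cast h2.le
  have hsplit : ∀ j : ℕ, ((2 : ℝ) ^ j) ^ (β + 1) = 2 ^ j * ((2 : ℝ) ^ j) ^ β := fun j => by
    rw [Real.rpow_add (by positivity), Real.rpow_one, mul_comm]
  -- One constant for both comparisons: 2^|β| for the variation of n^β in a block, (1 + M)^p for
  -- that of c, and 2^|β+1| for moving from 2^j to 2^(j+1). The upper comparison does not need the
  -- last factor, which is at least 1.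
  refine summable_iff_of_dyadic_blocks (f := fun n : ℕ => (n : ℝ) ^ β * c n ^ p)
    (K := 2 ^ |β + 1| * 2 ^ |β| * (1 + M) ^ p)
    (fun n hn => mul_nonneg (by positivity) (Real.rpow_nonneg (h0 n hn) p))
    (fun j => mul_nonneg (by positivity) (Real.rpow_nonneg (hA j) p)) (by positivity) ?_ ?_
  · intro j
    have hone : (1 : ℝ) ≤ 2 ^ |β + 1| := Real.one_le_rpow one_le_two (abs_nonneg _)
    calc ∑ n ∈ Finset.Ico (2 ^ j : ℕ) (2 ^ (j + 1)), (n : ℝ) ^ β * c n ^ p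
        ≤ ∑ n ∈ Finset.Ico (2 ^ j : ℕ) (2 ^ (j + 1)),
            2 ^ |β| * ((2 : ℝ) ^ j) ^ β * ((1 + M) * c (2 ^ j)) ^ p := by
          refine Finset.sum_le_sum fun n hn => ?_
          obtain ⟨h1, h2, h3⟩ := hmem hn
          have := h0 n h3
          gcongr
          · exact (hpow hn).1
          · exact le_of_doubling_variation hv Nat.one_le_two_pow h1 (by omega)
      _ = 1 * (2 ^ |β| * (1 + M) ^ p * (((2 : ℝ) ^ j) ^ (β + 1) * c (2 ^ j) ^ p)) := by
          rw [Finset.sum_const, nsmul_eq_mul, hcard, Real.mul_rpow (by positivity) (hA j), hsplit]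
          ring
      _ ≤ 2 ^ |β + 1| * (2 ^ |β| * (1 + M) ^ p * (((2 : ℝ) ^ j) ^ (β + 1) * c (2 ^ j) ^ p)) := by
          have := Real.rpow_nonneg (hA j) p
          gcongr
      _ = _ := by ring
  · intro j
    have hstep : ((2 : ℝ) ^ (j + 1)) ^ (β + 1) ≤ 2 ^ |β + 1| * ((2 : ℝ) ^ j) ^ (β + 1) :=
      (Real.rpow_le_two_rpow_abs_mul (β + 1) (by positivity)
        (pow_le_pow_right₀ one_le_two j.le_succ) (pow_succ' _ _).le).1
    calc ((2 : ℝ) ^ (j + 1)) ^ (β + 1) * c (2 ^ (j + 1)) ^ p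
        ≤ 2 ^ |β + 1| * ((2 : ℝ) ^ j) ^ (β + 1) * c (2 ^ (j + 1)) ^ p := by
          have := Real.rpow_nonneg (hA (j + 1)) p
          gcongr
      _ = 2 ^ |β + 1| * ∑ n ∈ Finset.Ico (2 ^ j : ℕ) (2 ^ (j + 1)),
            ((2 : ℝ) ^ j) ^ β * c (2 ^ (j + 1)) ^ p := by
          rw [Finset.sum_const, nsmul_eq_mul, hcard, hsplit]
          ring
      _ ≤ 2 ^ |β + 1| * ∑ n ∈ Finset.Ico (2 ^ j : ℕ) (2 ^ (j + 1)),
            2 ^ |β| * (n : ℝ) ^ β * ((1 + M) * c n) ^ p := by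
          gcongr with n hn
          · exact Real.rpow_nonneg (hA (j + 1)) p
          · exact (hpow hn).2
          · exact hA _
          · obtain ⟨h1, h2, h3⟩ := hmem hn
            exact le_of_doubling_variation hv h3 (by rw [pow_succ']; omega) (by rw [pow_succ']; omega)
      _ = _ := by
          rw [Finset.mul_sum, Finset.mul_sum]
          refine Finset.sum_congr rfl fun n hn => ?_
          rw [Real.mul_rpow (by positivity) (h0 n (hmem hn).2.2)]
          ring

end GBV

/-! ### The kernel 2^min(i,j) -/

/-- The ratio `2 ^ (-min α (1 - α))` of the geometric kernel attached to `α ∈ (0, 1)`. -/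
noncomputable def dyadicRatio (α : ℝ) : ℝ := 2 ^ (-min α (1 - α))

/-- Convolution of a sequence with the two-sided geometric kernel of ratio `dyadicRatio α`. -/
noncomputable def dyadicConv (α : ℝ) (B : ℕ → ℝ) (j : ℕ) : ℝ :=
  ∑' i : ℕ, dyadicRatio α ^ ((i : ℤ) - j).natAbs * B i

theorem dyadicRatio_pos (α : ℝ) : 0 < dyadicRatio α := Real.rpow_pos_of_pos two_pos _

theorem dyadicRatio_lt_one {α : ℝ} (h0 : 0 < α) (h1 : α < 1) : dyadicRatio α < 1 :=
  Real.rpow_lt_one_of_one_lt_of_neg one_lt_two (neg_lt_zero.2 (lt_min h0 (by linarith)))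

theorem dyadicConv_nonneg {α : ℝ} {B : ℕ → ℝ} (hB : ∀ i, 0 ≤ B i) (j : ℕ) :
    0 ≤ dyadicConv α B j :=
  tsum_nonneg fun i => mul_nonneg (pow_nonneg (dyadicRatio_pos α).le _) (hB i)

/-- In exponents of 2, equality holds with decay rate 1 - α when i ≤ j and with rate α when i ≥ j;
the ratio uses the smaller rate. -/
theorem two_pow_min_le {α : ℝ} (h0 : 0 < α) (h1 : α < 1) (i j : ℕ) :
    (2 : ℝ) ^ min i j ≤
      ((2 : ℝ) ^ j) ^ (1 - α) * (dyadicRatio α ^ ((i : ℤ) - j).natAbs * ((2 : ℝ) ^ i) ^ α) := by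
  have e : ((2 : ℝ) ^ j) ^ (1 - α) * (dyadicRatio α ^ ((i : ℤ) - j).natAbs * ((2 : ℝ) ^ i) ^ α)
      = 2 ^ (j * (1 - α) + (-min α (1 - α) * ((i : ℤ) - j).natAbs + i * α) : ℝ) := by
    rw [Real.rpow_add two_pos, Real.rpow_add two_pos, Real.rpow_natCast_mul zero_le_two,
      Real.rpow_natCast_mul zero_le_two, Real.rpow_mul_natCast zero_le_two, dyadicRatio]
  rw [e, ← Real.rpow_natCast]
  refine Real.rpow_le_rpow_of_exponent_le one_le_two ?_
  have hα := min_le_left α (1 - α)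
  have hα' := min_le_right α (1 - α)
  rcases le_total i j with h | h
  · have h' : ((((i : ℤ) - j).natAbs : ℕ) : ℝ) = j - i := by
      rw [Nat.cast_natAbs, abs_sub_comm, abs_of_nonneg (by simpa using h)]
      push_cast
      ring
    have hij : (i : ℝ) ≤ j := by exact_mod_cast h
    rw [h', min_eq_left h]
    nlinarith
  · have h' : ((((i : ℤ) - j).natAbs : ℕ) : ℝ) = i - j := by
      rw [Nat.cast_natAbs, abs_of_nonneg (by simpa using h)]
      push_cast
      ring
    have hij : (j : ℝ) ≤ i := by exact_mod_cast h
    rw [h', min_eq_right h]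
    nlinarith

/-- Used twice: with D the dyadic coefficients, and with D the integrals of |φ| over dyadic
intervals. -/
theorem sum_two_pow_min_le {α : ℝ} (h0 : 0 < α) (h1 : α < 1) {D : ℕ → ℝ} (hD : ∀ i, 0 ≤ D i)
    {p : ℝ} (hp : 1 < p) (hs : Summable fun i => (((2 : ℝ) ^ i) ^ α * D i) ^ p) (j J : ℕ) :
    ∑ i ∈ Finset.range J, (2 : ℝ) ^ min i j * D i ≤
      ((2 : ℝ) ^ j) ^ (1 - α) * dyadicConv α (fun i => ((2 : ℝ) ^ i) ^ α * D i) j := by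
  have hB : ∀ i, 0 ≤ ((2 : ℝ) ^ i) ^ α * D i := fun i => mul_nonneg (by positivity) (hD i)
  have hsum := (summable_geometric_conv (dyadicRatio_pos α).le (dyadicRatio_lt_one h0 h1) hp
    hB hs).1 j
  calc ∑ i ∈ Finset.range J, (2 : ℝ) ^ min i j * D i
      ≤ ∑ i ∈ Finset.range J, ((2 : ℝ) ^ j) ^ (1 - α) *
          (dyadicRatio α ^ ((i : ℤ) - j).natAbs * (((2 : ℝ) ^ i) ^ α * D i)) := by
        refine Finset.sum_le_sum fun i _ => ?_
        have := mul_le_mul_of_nonneg_right (two_pow_min_le h0 h1 i j) (hD i)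
        linarith
    _ ≤ _ := by
        rw [← Finset.mul_sum]
        gcongr
        exact hsum.sum_le_tsum _ fun i _ =>
          mul_nonneg (pow_nonneg (dyadicRatio_pos α).le _) (hB i)

/-! ### Abel summation on the unit circle -/

theorem sum_mul_pow_mul_sub_one (c : ℕ → ℝ) (z : ℂ) {m N : ℕ} (h : m ≤ N) :
    (∑ n ∈ Finset.Ico m N, (c n : ℂ) * z ^ n) * (z - 1) = c N * z ^ N - c m * z ^ m +
      ∑ n ∈ Finset.Ico m N, ((c n - c (n + 1) : ℝ) : ℂ) * z ^ (n + 1) := by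
  induction N, h using Nat.le_induction with
  | base => simp
  | succ N hN ih =>
    rw [Finset.sum_Ico_succ_top hN, Finset.sum_Ico_succ_top hN, add_mul, ih]
    push_cast
    ring

/-- In Abel's identity the boundary term c N is telescoped back to c m, which costs a second copy of
c m plus the variation. -/
theorem norm_sum_mul_pow_le {c : ℕ → ℝ} {z : ℂ} (hz : ‖z‖ = 1) {m N : ℕ} (h : m ≤ N)
    (hm : 0 ≤ c m) :
    ‖∑ n ∈ Finset.Ico m N, (c n : ℂ) * z ^ n‖ * ‖z - 1‖ ≤
      2 * (c m + ∑ n ∈ Finset.Ico m N, |c n - c (n + 1)|) := by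
  have hN : |c N| ≤ c m + ∑ n ∈ Finset.Ico m N, |c n - c (n + 1)| := by
    have := dist_le_Ico_sum_dist c h
    simp only [Real.dist_eq] at this
    have h2 := abs_sub_abs_le_abs_sub (c N) (c m)
    rw [abs_sub_comm, abs_of_nonneg hm] at h2
    linarith
  rw [← norm_mul, sum_mul_pow_mul_sub_one c z h]
  calc _ ≤ ‖(c N : ℂ) * z ^ N‖ + ‖(c m : ℂ) * z ^ m‖ +
        ∑ n ∈ Finset.Ico m N, ‖((c n - c (n + 1) : ℝ) : ℂ) * z ^ (n + 1)‖ :=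
        (norm_add_le _ _).trans (add_le_add (norm_sub_le _ _) (norm_sum_le _ _))
    _ = |c N| + c m + ∑ n ∈ Finset.Ico m N, |c n - c (n + 1)| := by
        simp only [norm_mul, norm_pow, hz, one_pow, mul_one, Complex.norm_real, Real.norm_eq_abs,
          abs_of_nonneg hm]
    _ ≤ _ := by linarith

/-- Jordan's inequality for sin(x/2), since the norm equals 2|sin(x/2)|. -/
theorem two_mul_abs_le_pi_mul_norm_exp_sub_one {x : ℝ} (hx : |x| ≤ Real.pi) :
    2 * |x| ≤ Real.pi * ‖Complex.exp (Complex.I * x) - 1‖ := by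
  have h := Real.mul_abs_le_abs_sin (x := x / 2) (by rw [abs_div, abs_two]; linarith)
  rw [Complex.norm_exp_I_mul_ofReal_sub_one, norm_mul, Real.norm_two, Real.norm_eq_abs]
  rw [abs_div, abs_two, div_mul_div_comm, mul_comm Real.pi, mul_div_mul_left _ _ two_ne_zero,
    div_le_iff₀ Real.pi_pos] at h
  linarith

theorem one_le_two_pow_mul_norm_exp_sub_one {x : ℝ} {j : ℕ} (hx : Real.pi < 2 ^ (j + 1) * |x|)
    (hx' : |x| ≤ Real.pi) : 1 ≤ 2 ^ j * ‖Complex.exp (Complex.I * x) - 1‖ := by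
  have h := two_mul_abs_le_pi_mul_norm_exp_sub_one hx'
  have hpi := Real.pi_pos
  have h2 : (0 : ℝ) < 2 ^ j := by positivity
  rw [pow_succ] at hx
  have : Real.pi * 1 ≤ Real.pi * (2 ^ j * ‖Complex.exp (Complex.I * x) - 1‖) := by nlinarith
  exact le_of_mul_le_mul_left this hpi

theorem norm_exp_I_mul (x : ℝ) : ‖Complex.exp (Complex.I * x)‖ = 1 := by
  rw [mul_comm]; exact Complex.norm_exp_ofReal_mul_I x

section GBV

variable {c : ℕ → ℝ} {M : ℝ}

/-- The dyadic subsequence of `c`, with `|c 0|` added to its first term. -/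
noncomputable def dyadicTerm (c : ℕ → ℝ) (i : ℕ) : ℝ := c (2 ^ i) + if i = 0 then |c 0| else 0

theorem dyadicTerm_nonneg (h0 : ∀ n : ℕ, 1 ≤ n → 0 ≤ c n) (i : ℕ) : 0 ≤ dyadicTerm c i :=
  add_nonneg (h0 _ Nat.one_le_two_pow) (by split_ifs <;> simp)

/-- The sum is cut at n = 2^j, comparable to 1/|x|. Below the cut absolute values suffice; above it
Abel summation costs 1/|z - 1| ≤ 2^j times the variation. -/
theorem norm_partial_sum_le (h0 : ∀ n : ℕ, 1 ≤ n → 0 ≤ c n) (hM : 0 < M)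
    (hv : ∀ m : ℕ, 1 ≤ m → ∑ n ∈ Finset.Icc m (2 * m), |c n - c (n + 1)| ≤ M * c m)
    {x : ℝ} {j : ℕ} (hx : Real.pi < 2 ^ (j + 1) * |x|) (hx' : |x| ≤ Real.pi) {N J : ℕ}
    (hjJ : j < J) (hN : N ≤ 2 ^ J) :
    ‖∑ n ∈ Finset.range N, (c n : ℂ) * Complex.exp (Complex.I * x) ^ n‖ ≤
      2 * (1 + M) * ∑ i ∈ Finset.range J, 2 ^ min i j * dyadicTerm c i := by
  set z := Complex.exp (Complex.I * x)
  have hz : ‖z‖ = 1 := norm_exp_I_mul x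
  have hA : ∀ i : ℕ, 0 ≤ c (2 ^ i) := fun i => h0 _ Nat.one_le_two_pow
  have hterm : ∀ n, ‖(c n : ℂ) * z ^ n‖ = |c n| := fun n => by
    rw [norm_mul, norm_pow, hz, one_pow, mul_one, Complex.norm_real, Real.norm_eq_abs]
  have hhead : ∀ N ≤ 2 ^ j, ‖∑ n ∈ Finset.range N, (c n : ℂ) * z ^ n‖ ≤
      |c 0| + (1 + M) * ∑ i ∈ Finset.range j, 2 ^ i * c (2 ^ i) := by
    intro N hN
    calc _ ≤ ∑ n ∈ Finset.range N, |c n| := by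
          refine (norm_sum_le _ _).trans (Finset.sum_le_sum fun n _ => (hterm n).le)
      _ ≤ ∑ n ∈ Finset.range (2 ^ j), |c n| :=
          Finset.sum_le_sum_of_subset_of_nonneg (Finset.range_subset_range.2 hN)
            fun i _ _ => abs_nonneg _
      _ = |c 0| + ∑ n ∈ Finset.Ico 1 (2 ^ j), |c n| := by
          rw [Finset.range_eq_Ico, Finset.sum_eq_sum_Ico_succ_bot (by positivity)]
      _ ≤ _ := by
          rw [sum_Ico_two_pow, Finset.mul_sum]
          gcongr with i hi
          calc ∑ n ∈ Finset.Ico (2 ^ i) (2 ^ (i + 1)), |c n|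
              ≤ ∑ n ∈ Finset.Ico (2 ^ i : ℕ) (2 ^ (i + 1)), (1 + M) * c (2 ^ i) := by
                refine Finset.sum_le_sum fun n hn => ?_
                rw [Finset.mem_Ico, pow_succ] at hn
                rw [abs_of_nonneg (h0 n (Nat.one_le_two_pow.trans hn.1))]
                exact le_of_doubling_variation hv Nat.one_le_two_pow hn.1 (by omega)
            _ = _ := by
                rw [Finset.sum_const, nsmul_eq_mul, Nat.card_Ico, pow_succ, mul_two,
                  Nat.add_sub_cancel]
                push_cast
                ring
  have htail : ∀ N, 2 ^ j ≤ N → N ≤ 2 ^ J →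
      ‖∑ n ∈ Finset.Ico (2 ^ j) N, (c n : ℂ) * z ^ n‖ ≤
        2 * (1 + M) * (2 ^ j * ∑ i ∈ Finset.Ico j J, c (2 ^ i)) := by
    intro N hjN hN
    have h1 := norm_sum_mul_pow_le (c := c) hz hjN (hA j)
    have h2 := one_le_two_pow_mul_norm_exp_sub_one hx hx'
    have h3 : ∑ n ∈ Finset.Ico (2 ^ j) N, |c n - c (n + 1)| ≤ M * ∑ i ∈ Finset.Ico j J, c (2 ^ i) :=
      (Finset.sum_le_sum_of_subset_of_nonneg (Finset.Ico_subset_Ico_right hN)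
        fun i _ _ => abs_nonneg _).trans (sum_dyadic_variation_le hv hjJ.le)
    -- The boundary term is itself a summand; this is where j < J is strict.
    have h4 : c (2 ^ j) ≤ ∑ i ∈ Finset.Ico j J, c (2 ^ i) :=
      Finset.single_le_sum (f := fun i => c (2 ^ i)) (fun i _ => hA i)
        (Finset.mem_Ico.2 ⟨le_rfl, hjJ⟩)
    set s := ∑ i ∈ Finset.Ico j J, c (2 ^ i)
    set y := ‖∑ n ∈ Finset.Ico (2 ^ j) N, (c n : ℂ) * z ^ n‖
    have hy : 0 ≤ y := norm_nonneg _
    calc y ≤ y * (2 ^ j * ‖z - 1‖) := le_mul_of_one_le_right hy h2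
      _ = 2 ^ j * (y * ‖z - 1‖) := by ring
      _ ≤ 2 ^ j * (2 * (s + M * s)) := by
          refine mul_le_mul_of_nonneg_left ?_ (by positivity)
          linarith
      _ = _ := by ring
  have hsplit : ∑ i ∈ Finset.range J, 2 ^ min i j * dyadicTerm c i = |c 0| +
      ∑ i ∈ Finset.range j, 2 ^ i * c (2 ^ i) + 2 ^ j * ∑ i ∈ Finset.Ico j J, c (2 ^ i) := by
    -- The kernel equals 1 at i = 0, so the unconstrained |c 0| enters with weight 1.
    have e1 : ∑ i ∈ Finset.range J, (2 : ℝ) ^ min i j * (if i = 0 then |c 0| else 0) = |c 0| := by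
      rw [Finset.sum_eq_single_of_mem 0 (Finset.mem_range.2 (by omega))]
      · simp
      · intro i _ hi
        simp [hi]
    simp only [dyadicTerm, mul_add, Finset.sum_add_distrib]
    rw [e1, ← Finset.sum_range_add_sum_Ico _ hjJ.le, add_comm, add_assoc, Finset.mul_sum]
    congr 2
    · refine Finset.sum_congr rfl fun i hi => ?_
      rw [min_eq_left (Finset.mem_range.1 hi).le]
    · refine Finset.sum_congr rfl fun i hi => ?_
      rw [min_eq_right (Finset.mem_Ico.1 hi).1]
  have hs1 : 0 ≤ ∑ i ∈ Finset.range j, (2 : ℝ) ^ i * c (2 ^ i) :=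
    Finset.sum_nonneg fun i _ => mul_nonneg (by positivity) (hA i)
  have hs2 : 0 ≤ (2 : ℝ) ^ j * ∑ i ∈ Finset.Ico j J, c (2 ^ i) :=
    mul_nonneg (by positivity) (Finset.sum_nonneg fun i _ => hA i)
  have hc0 := abs_nonneg (c 0)
  rw [hsplit]
  rcases le_total N (2 ^ j) with h | h
  · have := hhead N h
    nlinarith [mul_nonneg hM.le hs1, mul_nonneg hM.le hs2, mul_nonneg hM.le hc0]
  · rw [← Finset.sum_range_add_sum_Ico _ h]
    have h1 := hhead _ le_rfl
    have h2 := htail N h hN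
    refine (norm_add_le _ _).trans ?_
    nlinarith [mul_nonneg hM.le hs1, mul_nonneg hM.le hc0]

/-- Dirichlet's test: every term of Abel's identity converges, and z - 1 can be divided out. -/
theorem exists_tendsto_sum_mul_pow (hlim : Tendsto c atTop (𝓝 0))
    (hvar : Summable fun n => |c n - c (n + 1)|) {z : ℂ} (hz : ‖z‖ = 1) (hz1 : z ≠ 1) :
    ∃ s, Tendsto (fun N => ∑ n ∈ Finset.range N, (c n : ℂ) * z ^ n) atTop (𝓝 s) := by
  have hne : z - 1 ≠ 0 := sub_ne_zero.2 hz1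
  have h1 : Tendsto (fun N => (c N : ℂ) * z ^ N) atTop (𝓝 0) := by
    rw [tendsto_zero_iff_norm_tendsto_zero]
    simpa [hz] using hlim.abs
  have h2 : Summable fun n => ((c n - c (n + 1) : ℝ) : ℂ) * z ^ (n + 1) := by
    refine Summable.of_norm (hvar.congr fun n => ?_)
    rw [norm_mul, norm_pow, hz, one_pow, mul_one, Complex.norm_real, Real.norm_eq_abs]
  refine ⟨_, (((h1.sub_const (c 0 * z ^ 0)).add h2.hasSum.tendsto_sum_nat).div_const
    (z - 1)).congr fun N => ?_⟩
  have := sum_mul_pow_mul_sub_one c z (Nat.zero_le N)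
  rw [← Finset.range_eq_Ico] at this
  rw [← this, mul_div_cancel_right₀ _ hne]

theorem summable_variation (h0 : ∀ n : ℕ, 1 ≤ n → 0 ≤ c n) (hM : 0 < M)
    (hv : ∀ m : ℕ, 1 ≤ m → ∑ n ∈ Finset.Icc m (2 * m), |c n - c (n + 1)| ≤ M * c m)
    (hs : Summable fun i => c (2 ^ i)) : Summable fun n => |c n - c (n + 1)| := by
  refine summable_of_sum_range_le (c := |c 0 - c 1| + M * ∑' i, c (2 ^ i))
    (fun n => abs_nonneg _) fun N => ?_
  calc ∑ n ∈ Finset.range N, |c n - c (n + 1)|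
      ≤ ∑ n ∈ Finset.range (2 ^ N), |c n - c (n + 1)| :=
        Finset.sum_le_sum_of_subset_of_nonneg
          (Finset.range_subset_range.2 N.lt_two_pow_self.le) fun i _ _ => abs_nonneg _
    _ = |c 0 - c 1| + ∑ n ∈ Finset.Ico (2 ^ 0) (2 ^ N), |c n - c (n + 1)| := by
        rw [Finset.range_eq_Ico, Finset.sum_eq_sum_Ico_succ_bot (by positivity)]
        simp
    _ ≤ _ := by
        gcongr
        refine (sum_dyadic_variation_le hv N.zero_le).trans ?_
        gcongr
        exact hs.sum_le_tsum _ fun i _ => h0 _ Nat.one_le_two_pow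

/-- Each term of the given series is at most its sum, so A i = O(2^(-αi)). -/
theorem summable_of_summable_weighted_rpow {α : ℝ} (hα : 0 < α) {p : ℝ} (hp : 0 < p) {A : ℕ → ℝ}
    (hA : ∀ i, 0 ≤ A i) (hs : Summable fun i => (((2 : ℝ) ^ i) ^ α * A i) ^ p) : Summable A := by
  have hb : ∀ i, A i ≤ (∑' i, (((2 : ℝ) ^ i) ^ α * A i) ^ p) ^ (1 / p) * ((2 : ℝ) ^ (-α)) ^ i := by
    intro i
    have hnn : ∀ i, 0 ≤ ((2 : ℝ) ^ i) ^ α * A i := fun i => mul_nonneg (by positivity) (hA i)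
    have h1 := hs.le_tsum i fun k _ => Real.rpow_nonneg (hnn k) p
    have h2 := Real.rpow_le_rpow (Real.rpow_nonneg (hnn i) p) h1 (z := 1 / p) (by positivity)
    rw [← Real.rpow_mul (hnn i), mul_one_div_cancel hp.ne', Real.rpow_one] at h2
    have e : ((2 : ℝ) ^ (-α)) ^ i = (((2 : ℝ) ^ i) ^ α)⁻¹ := by
      rw [← Real.rpow_mul_natCast zero_le_two, ← Real.rpow_natCast_mul zero_le_two,
        ← Real.rpow_neg zero_le_two]
      ring_nf
    rw [e, ← div_eq_mul_inv, le_div_iff₀ (by positivity), mul_comm]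
    exact h2
  exact Summable.of_nonneg_of_le hA hb ((summable_geometric_of_lt_one (by positivity)
    (Real.rpow_lt_one_of_one_lt_of_neg one_lt_two (by linarith))).mul_left _)

end GBV

/-! ### Real and imaginary parts; dyadic scales in (0, π] -/

/-- A cosine or sine series is the image of a power series on the unit circle under a
real-linear contraction. -/
theorem exists_clm_trig_sum {a b c : ℕ → ℝ}
    (hab : (a = c ∧ b = fun _ => 0) ∨ ((a = fun _ => 0) ∧ b = c)) :
    ∃ L : ℂ →L[ℝ] ℝ, (∀ w, |L w| ≤ ‖w‖) ∧ ∀ (N : ℕ) (x : ℝ),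
      ∑ n ∈ Finset.range N, (a n * Real.cos (n * x) + b n * Real.sin (n * x)) =
        L (∑ n ∈ Finset.range N, (c n : ℂ) * Complex.exp (Complex.I * x) ^ n) := by
  have hexp : ∀ (n : ℕ) (x : ℝ), Complex.exp (Complex.I * x) ^ n =
      Complex.exp (((n * x : ℝ) : ℂ) * Complex.I) := by
    intro n x
    rw [← Complex.exp_nat_mul]
    push_cast
    ring_nf
  rcases hab with ⟨rfl, rfl⟩ | ⟨rfl, rfl⟩
  · refine ⟨Complex.reCLM, Complex.abs_re_le_norm, fun N x => ?_⟩
    rw [map_sum]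
    refine Finset.sum_congr rfl fun n _ => ?_
    rw [Complex.reCLM_apply, Complex.re_ofReal_mul, hexp, Complex.exp_ofReal_mul_I_re]
    ring
  · refine ⟨Complex.imCLM, Complex.abs_im_le_norm, fun N x => ?_⟩
    rw [map_sum]
    refine Finset.sum_congr rfl fun n _ => ?_
    rw [Complex.imCLM_apply, Complex.im_ofReal_mul, hexp, Complex.exp_ofReal_mul_I_im]
    ring

theorem exists_dyadic_scale {x : ℝ} (h0 : 0 < x) (hx : x ≤ Real.pi) :
    ∃ j : ℕ, Real.pi < 2 ^ (j + 1) * x ∧ 2 ^ j * x ≤ Real.pi := by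
  obtain ⟨j, h1, h2⟩ := exists_nat_pow_near ((one_le_div h0).2 hx) (one_lt_two (α := ℝ))
  exact ⟨j, (div_lt_iff₀ h0).1 h2, (le_div_iff₀ h0).1 h1⟩

/-- Here 2^j x lies in (π/2, π], hence in [1, π], so its powers of either sign are at most π^|δ|. -/
theorem Real.rpow_le_of_dyadic_scale {x : ℝ} {j : ℕ} (h1 : Real.pi < 2 ^ (j + 1) * x)
    (h2 : 2 ^ j * x ≤ Real.pi) (δ : ℝ) : x ^ δ ≤ Real.pi ^ |δ| * ((2 : ℝ) ^ j) ^ (-δ) := by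
  have hpi := Real.pi_gt_three
  have hj : (0 : ℝ) < 2 ^ j := by positivity
  rw [pow_succ] at h1
  have hu : 1 ≤ 2 ^ j * x := by linarith
  have hx : 0 < x := pos_of_mul_pos_right (by linarith) hj.le
  have h : (2 ^ j * x) ^ δ ≤ Real.pi ^ |δ| :=
    (Real.rpow_le_rpow_of_exponent_le hu (le_abs_self δ)).trans
      (Real.rpow_le_rpow (by linarith) h2 (abs_nonneg δ))
  rw [Real.mul_rpow hj.le hx.le] at h
  rw [Real.rpow_neg hj.le, ← div_eq_mul_inv, le_div_iff₀ (by positivity), mul_comm]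
  exact h

/-- The dyadic interval `(π / 2 ^ (j + 1), π / 2 ^ j]`. -/
def dyadicIoc (j : ℕ) : Set ℝ := Set.Ioc (Real.pi / 2 ^ (j + 1)) (Real.pi / 2 ^ j)

theorem mem_dyadicIoc {j : ℕ} {x : ℝ} :
    x ∈ dyadicIoc j ↔ Real.pi < 2 ^ (j + 1) * x ∧ 2 ^ j * x ≤ Real.pi := by
  rw [dyadicIoc, Set.mem_Ioc, div_lt_iff₀' (by positivity), le_div_iff₀' (by positivity)]

theorem measurableSet_dyadicIoc (j : ℕ) : MeasurableSet (dyadicIoc j) := measurableSet_Ioc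

theorem volume_dyadicIoc (j : ℕ) :
    volume (dyadicIoc j) = ENNReal.ofReal (Real.pi / 2 ^ (j + 1)) := by
  rw [dyadicIoc, Real.volume_Ioc, pow_succ]
  congr 1
  field_simp
  ring

theorem pairwise_disjoint_dyadicIoc : Pairwise (Function.onFun Disjoint dyadicIoc) := by
  have : Antitone fun j : ℕ => Real.pi / (2 : ℝ) ^ j := fun i j h =>
    div_le_div_of_nonneg_left Real.pi_pos.le (by positivity) (pow_le_pow_right₀ one_le_two h)
  exact this.pairwise_disjoint_on_Ioc_succ

theorem iUnion_dyadicIoc : ⋃ j, dyadicIoc j = Set.Ioc 0 Real.pi := by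
  ext x
  simp only [Set.mem_iUnion, mem_dyadicIoc, Set.mem_Ioc]
  constructor
  · rintro ⟨j, h1, h2⟩
    have hx : 0 < x := pos_of_mul_pos_right (Real.pi_pos.trans h1) (by positivity)
    refine ⟨hx, le_trans ?_ h2⟩
    exact le_mul_of_one_le_left hx.le (one_le_pow₀ one_le_two)
  · rintro ⟨h0, hx⟩
    exact exists_dyadic_scale h0 hx

/-- The factor 2^j cancels the length π/2^(j+1). Only subadditivity is used, so h need not be
measurable. -/
theorem lintegral_lt_top_of_dyadic_bound {h : ℝ → ENNReal} {s : ℕ → ℝ} (hs : Summable s)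
    (hh : ∀ j, ∀ x ∈ dyadicIoc j, h x ≤ ENNReal.ofReal (2 ^ j * s j)) :
    ∫⁻ x in Set.Ioc 0 Real.pi, h x < ⊤ := by
  rw [← iUnion_dyadicIoc]
  refine (lintegral_iUnion_le _ _).trans_lt ?_
  have hb : ∀ j, ∫⁻ x in dyadicIoc j, h x ≤ ENNReal.ofReal (Real.pi / 2 * s j) := by
    intro j
    refine (setLIntegral_mono measurable_const (hh j)).trans ?_
    rw [setLIntegral_const, volume_dyadicIoc, mul_comm, ← ENNReal.ofReal_mul (by positivity)]
    refine ENNReal.ofReal_le_ofReal (le_of_eq ?_)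
    rw [pow_succ]
    field_simp
  refine (ENNReal.tsum_le_tsum hb).trans_lt ?_
  exact (hs.mul_left _).tsum_ofReal_ne_top.lt_top

/-! ### Orthogonality and Fourier coefficients of dominated limits -/

theorem integral_cos_int_mul (m : ℤ) :
    ∫ x in (-Real.pi)..Real.pi, Real.cos (m * x) = if m = 0 then 2 * Real.pi else 0 := by
  split_ifs with h
  · simp [h]
    ring
  · have hm : (m : ℝ) ≠ 0 := by exact_mod_cast h
    rw [intervalIntegral.integral_comp_mul_left _ hm, integral_cos, mul_neg, Real.sin_neg,
      Real.sin_int_mul_pi]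
    simp

theorem integral_sin_int_mul (m : ℤ) : ∫ x in (-Real.pi)..Real.pi, Real.sin (m * x) = 0 := by
  have h := intervalIntegral.integral_comp_neg (a := -Real.pi) (b := Real.pi)
    fun x => Real.sin (m * x)
  simp only [mul_neg, Real.sin_neg, neg_neg, intervalIntegral.integral_neg] at h
  linarith

theorem integral_cos_mul_cos (n k : ℕ) (hk : 1 ≤ k) :
    ∫ x in (-Real.pi)..Real.pi, Real.cos (n * x) * Real.cos (k * x) =
      if n = k then Real.pi else 0 := by
  have e : ∀ x : ℝ, Real.cos (n * x) * Real.cos (k * x) =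
      (Real.cos (((n - k : ℤ) : ℝ) * x) + Real.cos (((n + k : ℤ) : ℝ) * x)) / 2 := by
    intro x
    push_cast
    rw [sub_mul, add_mul, Real.cos_sub, Real.cos_add]
    ring
  simp_rw [e]
  rw [intervalIntegral.integral_div, intervalIntegral.integral_add
    (Continuous.intervalIntegrable (by fun_prop) _ _)
    (Continuous.intervalIntegrable (by fun_prop) _ _), integral_cos_int_mul, integral_cos_int_mul,
    if_neg (show (n + k : ℤ) ≠ 0 by omega)]
  by_cases h : n = k
  · rw [if_pos h, if_pos (by omega)]; ring
  · rw [if_neg h, if_neg (by omega)]; ring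

theorem integral_sin_mul_sin (n k : ℕ) (hk : 1 ≤ k) :
    ∫ x in (-Real.pi)..Real.pi, Real.sin (n * x) * Real.sin (k * x) =
      if n = k then Real.pi else 0 := by
  have e : ∀ x : ℝ, Real.sin (n * x) * Real.sin (k * x) =
      (Real.cos (((n - k : ℤ) : ℝ) * x) - Real.cos (((n + k : ℤ) : ℝ) * x)) / 2 := by
    intro x
    push_cast
    rw [sub_mul, add_mul, Real.cos_sub, Real.cos_add]
    ring
  simp_rw [e]
  rw [intervalIntegral.integral_div, intervalIntegral.integral_sub
    (Continuous.intervalIntegrable (by fun_prop) _ _)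
    (Continuous.intervalIntegrable (by fun_prop) _ _), integral_cos_int_mul, integral_cos_int_mul,
    if_neg (show (n + k : ℤ) ≠ 0 by omega)]
  by_cases h : n = k
  · rw [if_pos h, if_pos (by omega)]; ring
  · rw [if_neg h, if_neg (by omega)]; ring

theorem integral_sin_mul_cos (n k : ℕ) :
    ∫ x in (-Real.pi)..Real.pi, Real.sin (n * x) * Real.cos (k * x) = 0 := by
  have e : ∀ x : ℝ, Real.sin (n * x) * Real.cos (k * x) =
      (Real.sin (((n - k : ℤ) : ℝ) * x) + Real.sin (((n + k : ℤ) : ℝ) * x)) / 2 := by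
    intro x
    push_cast
    rw [sub_mul, add_mul, Real.sin_sub, Real.sin_add]
    ring
  simp_rw [e]
  rw [intervalIntegral.integral_div, intervalIntegral.integral_add
    (Continuous.intervalIntegrable (by fun_prop) _ _)
    (Continuous.intervalIntegrable (by fun_prop) _ _), integral_sin_int_mul, integral_sin_int_mul]
  simp

/-- A function which is the dominated limit of the partial sums of a trigonometric series has
that series as its Fourier series. -/
theorem hasTrigFourierSeries_of_dominated {a b : ℕ → ℝ} {φ G : ℝ → ℝ}
    (hper : Function.Periodic φ (2 * Real.pi))
    (hG : IntegrableOn G (Set.Ioc (-Real.pi) Real.pi))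
    (hbd : ∀ N : ℕ, ∀ᵐ x ∂(volume.restrict (Set.Ioc (-Real.pi) Real.pi)),
      |∑ n ∈ Finset.range N, (a n * Real.cos (n * x) + b n * Real.sin (n * x))| ≤ G x)
    (hlim : ∀ᵐ x ∂(volume.restrict (Set.Ioc (-Real.pi) Real.pi)),
      TrigSeriesConvergesTo a b x (φ x)) : HasTrigFourierSeries φ a b := by
  have hpi := Real.pi_pos
  have hle : -Real.pi ≤ Real.pi := by linarith
  set S : ℕ → ℝ → ℝ := fun N x =>
    ∑ n ∈ Finset.range N, (a n * Real.cos (n * x) + b n * Real.sin (n * x)) with hS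
  have hSc : ∀ N, Continuous (S N) := fun N => by fun_prop
  have hφm : AEStronglyMeasurable φ (volume.restrict (Set.Ioc (-Real.pi) Real.pi)) :=
    aestronglyMeasurable_of_tendsto_ae atTop (fun N => (hSc N).aestronglyMeasurable) hlim
  have hφi : IntegrableOn φ (Set.Ioc (-Real.pi) Real.pi) := by
    refine Integrable.mono' hG hφm ?_
    filter_upwards [hlim, ae_all_iff.2 hbd] with x h1 h2
    exact le_of_tendsto' (h1.norm) h2
  -- By dominated convergence a moment of φ is the limit of the moments of S N. Orthogonality makes
  -- these constant once the partial sum contains the tested frequency k, that is for N ≥ k + 1.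
  have hmom : ∀ (u : ℝ → ℝ), Continuous u → (∀ x, |u x| ≤ 1) → ∀ (s : ℝ) (N₀ : ℕ),
      (∀ N, N₀ ≤ N → ∫ x in (-Real.pi)..Real.pi, S N x * u x = s) →
      ∫ x in (-Real.pi)..Real.pi, φ x * u x = s := by
    intro u hu hu1 s N₀ h
    have ht : Tendsto (fun N => ∫ x in (-Real.pi)..Real.pi, S N x * u x) atTop
        (𝓝 (∫ x in (-Real.pi)..Real.pi, φ x * u x)) := by
      simp only [intervalIntegral.integral_of_le hle]
      refine tendsto_integral_of_dominated_convergence G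
        (fun N => ((hSc N).mul hu).aestronglyMeasurable) hG (fun N => ?_) ?_
      · filter_upwards [hbd N] with x hx
        rw [norm_mul]
        calc ‖S N x‖ * ‖u x‖ ≤ ‖S N x‖ * 1 := by gcongr; exact hu1 x
          _ ≤ G x := by rw [mul_one]; exact hx
      · filter_upwards [hlim] with x hx
        exact hx.mul_const _
    refine tendsto_nhds_unique ht (tendsto_const_nhds.congr' ?_)
    filter_upwards [eventually_ge_atTop N₀] with N hN
    exact (h N hN).symm
  have hexp : ∀ (u : ℝ → ℝ), Continuous u → ∀ N, ∫ x in (-Real.pi)..Real.pi, S N x * u x =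
      ∑ n ∈ Finset.range N, (a n * (∫ x in (-Real.pi)..Real.pi, Real.cos (n * x) * u x) +
        b n * ∫ x in (-Real.pi)..Real.pi, Real.sin (n * x) * u x) := by
    intro u hu N
    simp only [hS, Finset.sum_mul, add_mul, mul_assoc]
    rw [intervalIntegral.integral_finsetSum
      fun i _ => Continuous.intervalIntegrable (by fun_prop) _ _]
    refine Finset.sum_congr rfl fun n _ => ?_
    rw [intervalIntegral.integral_add (Continuous.intervalIntegrable (by fun_prop) _ _)
      (Continuous.intervalIntegrable (by fun_prop) _ _), intervalIntegral.integral_const_mul,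
      intervalIntegral.integral_const_mul]
  refine ⟨hper, hφi, ?_, fun k hk => ?_, fun k hk => ?_⟩
  · have := hmom (fun _ => 1) continuous_const (by simp) (2 * Real.pi * a 0) 1 fun N hN => by
      rw [hexp _ continuous_const]
      have h1 := fun n : ℕ => integral_cos_int_mul n
      have h2 := fun n : ℕ => integral_sin_int_mul n
      simp only [Int.cast_natCast] at h1 h2
      simp only [mul_one, h1, h2, mul_zero, add_zero, Nat.cast_eq_zero]
      rw [Finset.sum_eq_single_of_mem 0 (Finset.mem_range.2 (by omega))]
      · simp [mul_comm]
      · intro n _ hn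
        simp [hn]
    simp only [mul_one] at this
    rw [this]
    field_simp
  · rw [hmom (fun x => Real.cos (k * x)) (by fun_prop) (fun x => Real.abs_cos_le_one _)
      (Real.pi * a k) (k + 1) fun N hN => by
        rw [hexp _ (by fun_prop)]
        simp only [integral_cos_mul_cos _ k hk, integral_sin_mul_cos]
        rw [Finset.sum_eq_single_of_mem k (Finset.mem_range.2 (by omega))]
        · simp [mul_comm]
        · intro n _ hn
          simp [hn]]
    field_simp
  · rw [hmom (fun x => Real.sin (k * x)) (by fun_prop) (fun x => Real.abs_sin_le_one _)
      (Real.pi * b k) (k + 1) fun N hN => by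
        rw [hexp _ (by fun_prop)]
        have h1 : ∀ n : ℕ, ∫ x in (-Real.pi)..Real.pi, Real.cos (n * x) * Real.sin (k * x) = 0 := by
          intro n
          simpa only [mul_comm] using integral_sin_mul_cos k n
        simp only [integral_sin_mul_sin _ k hk, h1]
        rw [Finset.sum_eq_single_of_mem k (Finset.mem_range.2 (by omega))]
        · simp [mul_comm]
        · intro n _ hn
          simp [hn]]
    field_simp

/-! ### From coefficients to the function -/

/-- At scale j the weight is O(2^(jγ)), and γ + (1 - α) = 1/p for α = 1 + γ - 1/p. Hence |x^(-γ)
φ|^p = O(2^j E_j^p) on an interval of length π/2^(j+1). -/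
theorem weightedMemLp_of_dyadic_bound {p γ : ℝ} (hp : 1 < p) {φ : ℝ → ℝ}
    (hφ : AEStronglyMeasurable φ (volume.restrict (Set.Ioo 0 Real.pi))) {E : ℕ → ℝ}
    (hE : ∀ j, 0 ≤ E j) (hs : Summable fun j => E j ^ p)
    (hb : ∀ j, ∀ x ∈ dyadicIoc j,
      |φ x| ≤ ((2 : ℝ) ^ j) ^ (1 - (1 + γ - 1 / p)) * E j) :
    WeightedMemLp p γ φ := by
  have hp0 : 0 < p := by linarith
  refine ⟨?_, ?_⟩
  · exact (measurable_id.pow_const (-γ)).aestronglyMeasurable.mul hφ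
  rw [eLpNorm_lt_top_iff_lintegral_rpow_enorm_lt_top (by simpa using hp0) ENNReal.ofReal_ne_top,
    ENNReal.toReal_ofReal hp0.le, restrict_Ioo_eq_restrict_Ioc]
  have hs' : Summable fun j => (Real.pi ^ |γ| * E j) ^ p := by
    refine (hs.mul_left ((Real.pi ^ |γ|) ^ p)).congr fun j => ?_
    rw [Real.mul_rpow (by positivity) (hE j)]
  refine lintegral_lt_top_of_dyadic_bound hs' fun j x hx => ?_
  have h1 := hb j x hx
  rw [mem_dyadicIoc] at hx
  have h2 := Real.rpow_le_of_dyadic_scale hx.1 hx.2 (-γ)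
  rw [abs_neg, neg_neg] at h2
  have hx0 : 0 < x := pos_of_mul_pos_right (Real.pi_pos.trans hx.1) (by positivity)
  rw [Real.enorm_eq_ofReal_abs, ENNReal.ofReal_rpow_of_nonneg (abs_nonneg _) hp0.le]
  refine ENNReal.ofReal_le_ofReal ?_
  rw [abs_mul, abs_of_nonneg (Real.rpow_nonneg hx0.le _)]
  have e : Real.pi ^ |γ| * ((2 : ℝ) ^ j) ^ γ * (((2 : ℝ) ^ j) ^ (1 - (1 + γ - 1 / p)) * E j)
      = ((2 : ℝ) ^ j) ^ (1 / p) * (Real.pi ^ |γ| * E j) := by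
    rw [show (1 : ℝ) / p = γ + (1 - (1 + γ - 1 / p)) by ring, Real.rpow_add (by positivity)]
    ring_nf
  calc (x ^ (-γ) * |φ x|) ^ p
      ≤ (((2 : ℝ) ^ j) ^ (1 / p) * (Real.pi ^ |γ| * E j)) ^ p := by
        rw [← e]
        have := Real.rpow_nonneg hx0.le (-γ)
        gcongr
    _ = _ := by
        rw [Real.mul_rpow (by positivity) (mul_nonneg (by positivity) (hE j)),
          ← Real.rpow_mul (by positivity), one_div_mul_cancel hp0.ne', Real.rpow_one]

/-- An explicit formula for the scale, which makes the dyadic majorant visibly measurable. -/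
theorem natLog_floor_eq_of_dyadic_scale {x : ℝ} {j : ℕ} (h1 : Real.pi < 2 ^ (j + 1) * x)
    (h2 : 2 ^ j * x ≤ Real.pi) : Nat.log 2 ⌊Real.pi / x⌋₊ = j := by
  have hx : 0 < x := pos_of_mul_pos_right (Real.pi_pos.trans h1) (by positivity)
  have hpos : 0 ≤ Real.pi / x := by positivity
  rw [Nat.log_eq_iff (Or.inr ⟨one_lt_two, ?_⟩)]
  · constructor
    · refine Nat.le_floor ?_
      push_cast
      exact (le_div_iff₀ hx).2 h2
    · refine (Nat.floor_lt hpos).2 ?_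
      push_cast
      exact (div_lt_iff₀ hx).2 h1
  · have : 2 ^ j ≤ ⌊Real.pi / x⌋₊ := Nat.le_floor (by push_cast; exact (le_div_iff₀ hx).2 h2)
    have := Nat.one_le_two_pow (n := j)
    omega

section GBV

variable {c : ℕ → ℝ} {M : ℝ}

/-- Since E does not depend on N, one bound serves both to dominate the partial sums and to estimate
their limit. -/
theorem exists_partial_sum_bound (h0 : ∀ n : ℕ, 1 ≤ n → 0 ≤ c n) (hM : 0 < M)
    (hv : ∀ m : ℕ, 1 ≤ m → ∑ n ∈ Finset.Icc m (2 * m), |c n - c (n + 1)| ≤ M * c m)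
    {p α : ℝ} (hp : 1 < p) (hα0 : 0 < α) (hα1 : α < 1)
    (hs : Summable fun i : ℕ => (((2 : ℝ) ^ i) ^ α * c (2 ^ i)) ^ p) :
    ∃ E : ℕ → ℝ, (∀ j, 0 ≤ E j) ∧ (Summable fun j => E j ^ p) ∧
      ∀ (j : ℕ) (x : ℝ), Real.pi < 2 ^ (j + 1) * |x| → |x| ≤ Real.pi → ∀ N : ℕ,
        ‖∑ n ∈ Finset.range N, (c n : ℂ) * Complex.exp (Complex.I * x) ^ n‖ ≤
          ((2 : ℝ) ^ j) ^ (1 - α) * E j := by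
  have hsD : Summable fun i : ℕ => (((2 : ℝ) ^ i) ^ α * dyadicTerm c i) ^ p := by
    -- `dyadicTerm` differs from the dyadic subsequence only at i = 0, which the shift discards.
    rw [← summable_nat_add_iff 1] at hs ⊢
    refine hs.congr fun i => ?_
    simp [dyadicTerm]
  have hB : ∀ i : ℕ, 0 ≤ ((2 : ℝ) ^ i) ^ α * dyadicTerm c i := fun i =>
    mul_nonneg (by positivity) (dyadicTerm_nonneg h0 i)
  have hT := (summable_geometric_conv (dyadicRatio_pos α).le (dyadicRatio_lt_one hα0 hα1) hp
    hB hsD).2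
  have hTnn := dyadicConv_nonneg (α := α) hB
  refine ⟨fun j => 2 * (1 + M) * dyadicConv α (fun i => ((2 : ℝ) ^ i) ^ α * dyadicTerm c i) j,
    fun j => mul_nonneg (by positivity) (hTnn j), ?_, fun j x hx hx' N => ?_⟩
  · refine (hT.mul_left ((2 * (1 + M)) ^ p)).congr fun j => ?_
    rw [Real.mul_rpow (by positivity) (hTnn j), dyadicConv]
  · have hN : N ≤ 2 ^ (N + j + 1) :=
      N.lt_two_pow_self.le.trans (Nat.pow_le_pow_right two_pos (by omega))
    refine (norm_partial_sum_le h0 hM hv hx hx' (J := N + j + 1) (by omega) hN).trans ?_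
    have := sum_two_pow_min_le hα0 hα1 (dyadicTerm_nonneg h0) hp hsD j (N + j + 1)
    calc _ ≤ 2 * (1 + M) * (((2 : ℝ) ^ j) ^ (1 - α) *
          dyadicConv α (fun i => ((2 : ℝ) ^ i) ^ α * dyadicTerm c i) j) := by gcongr
      _ = _ := by ring

/-- The function equal to `(2 ^ j) ^ (1 - α) * E j` for `|x|` in the `j`-th dyadic interval. -/
noncomputable def dyadicMajorant (α : ℝ) (E : ℕ → ℝ) (x : ℝ) : ℝ :=
  ((2 : ℝ) ^ Nat.log 2 ⌊Real.pi / |x|⌋₊) ^ (1 - α) * E (Nat.log 2 ⌊Real.pi / |x|⌋₊)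

theorem measurable_dyadicMajorant (α : ℝ) (E : ℕ → ℝ) : Measurable (dyadicMajorant α E) :=
  (measurable_of_countable fun k : ℕ => ((2 : ℝ) ^ Nat.log 2 k) ^ (1 - α) * E (Nat.log 2 k)).comp
    (Nat.measurable_floor.comp (measurable_const.div measurable_norm))

/-- The value at scale j is 2^j · (2^(-jα) E j), and 2^(-jα) E j is summable because E is in ℓ^p and
α > 0. -/
theorem integrableOn_dyadicMajorant {p α : ℝ} (hp : 0 < p) (hα : 0 < α) {E : ℕ → ℝ}
    (hE : ∀ j, 0 ≤ E j) (hs : Summable fun j => E j ^ p) :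
    IntegrableOn (dyadicMajorant α E) (Set.Ioc (-Real.pi) Real.pi) := by
  have hpi := Real.pi_pos
  have hpos : IntegrableOn (dyadicMajorant α E) (Set.Ioc 0 Real.pi) := by
    refine ⟨(measurable_dyadicMajorant α E).aestronglyMeasurable, ?_⟩
    rw [hasFiniteIntegral_iff_enorm]
    have hsum : Summable fun j => ((2 : ℝ) ^ j) ^ (-α) * E j := by
      refine summable_of_summable_weighted_rpow hα hp
        (fun j => mul_nonneg (by positivity) (hE j)) (hs.congr fun j => ?_)
      rw [← mul_assoc, ← Real.rpow_add (by positivity), add_neg_cancel, Real.rpow_zero, one_mul]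
    refine lintegral_lt_top_of_dyadic_bound hsum fun j x hx => ?_
    rw [mem_dyadicIoc] at hx
    have hx0 : 0 < x := pos_of_mul_pos_right (hpi.trans hx.1) (by positivity)
    rw [Real.enorm_eq_ofReal_abs, dyadicMajorant, abs_of_pos hx0,
      natLog_floor_eq_of_dyadic_scale hx.1 hx.2,
      abs_of_nonneg (mul_nonneg (by positivity) (hE j)), sub_eq_add_neg,
      Real.rpow_add (by positivity), Real.rpow_one, mul_assoc]
  have heven : ∀ x, dyadicMajorant α E (-x) = dyadicMajorant α E x := fun x => by
    rw [dyadicMajorant, abs_neg, dyadicMajorant]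
  have h1 : IntervalIntegrable (dyadicMajorant α E) volume 0 Real.pi :=
    (intervalIntegrable_iff_integrableOn_Ioc_of_le hpi.le).2 hpos
  have h2 := (IntervalIntegrable.iff_comp_neg (by simp)).1 h1
  simp only [heven, neg_zero] at h2
  exact (intervalIntegrable_iff_integrableOn_Ioc_of_le (by linarith)).1 (h2.symm.trans h1)

theorem exists_hasTrigFourierSeries (h0 : ∀ n : ℕ, 1 ≤ n → 0 ≤ c n)
    (hlim : Tendsto c atTop (𝓝 0)) (hM : 0 < M)
    (hv : ∀ m : ℕ, 1 ≤ m → ∑ n ∈ Finset.Icc m (2 * m), |c n - c (n + 1)| ≤ M * c m)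
    {p γ : ℝ} (hp : 1 < p) (hγ₁ : 1 / p - 1 < γ) (hγ₂ : γ < 1 / p)
    (hs : Summable fun i : ℕ => (((2 : ℝ) ^ i) ^ (1 + γ - 1 / p) * c (2 ^ i)) ^ p)
    {a b : ℕ → ℝ} (hab : (a = c ∧ b = fun _ => 0) ∨ ((a = fun _ => 0) ∧ b = c)) :
    ∃ φ : ℝ → ℝ, HasTrigFourierSeries φ a b ∧ WeightedMemLp p γ φ ∧
      ∀ x : ℝ, (∀ k : ℤ, x ≠ 2 * Real.pi * k) → TrigSeriesConvergesTo a b x (φ x) := by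
  have hpi := Real.pi_pos
  have hp0 : 0 < p := by linarith
  have hα0 : 0 < 1 + γ - 1 / p := by linarith
  have hα1 : 1 + γ - 1 / p < 1 := by linarith
  obtain ⟨L, hL, hsum⟩ := exists_clm_trig_sum hab
  obtain ⟨E, hE, hEs, hbd⟩ := exists_partial_sum_bound h0 hM hv hp hα0 hα1 hs
  have hvar : Summable fun n => |c n - c (n + 1)| := summable_variation h0 hM hv
    (summable_of_summable_weighted_rpow hα0 hp0 (fun i => h0 _ Nat.one_le_two_pow) hs)
  -- At multiples of 2π the limit may be a default value; periodicity survives because the partial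
  -- sums themselves are periodic.
  let φ : ℝ → ℝ := fun x => limUnder atTop fun N : ℕ =>
    ∑ n ∈ Finset.range N, (a n * Real.cos (n * x) + b n * Real.sin (n * x))
  have hconv : ∀ x : ℝ, (∀ k : ℤ, x ≠ 2 * Real.pi * k) → TrigSeriesConvergesTo a b x (φ x) := by
    intro x hx
    have hz : Complex.exp (Complex.I * x) ≠ 1 := by
      rw [Ne, Complex.exp_eq_one_iff]
      rintro ⟨k, hk⟩
      refine hx k ?_
      have : (x : ℂ) = ((2 * Real.pi * k : ℝ) : ℂ) := by
        refine mul_left_cancel₀ Complex.I_ne_zero ?_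
        rw [hk]
        push_cast
        ring
      exact_mod_cast this
    obtain ⟨s, hs⟩ := exists_tendsto_sum_mul_pow hlim hvar (norm_exp_I_mul x) hz
    refine tendsto_nhds_limUnder ⟨L s, ?_⟩
    simp only [hsum]
    exact (L.continuous.tendsto s).comp hs
  have hconv' : ∀ x : ℝ, x ≠ 0 → |x| ≤ Real.pi → TrigSeriesConvergesTo a b x (φ x) := by
    intro x hx hx'
    refine hconv x fun k hk => ?_
    rcases eq_or_ne k 0 with rfl | hk0
    · exact hx (by simpa using hk)
    · have : (1 : ℝ) ≤ |(k : ℝ)| := by exact_mod_cast Int.one_le_abs hk0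
      rw [hk, abs_mul, abs_of_pos (by positivity)] at hx'
      nlinarith
  have hS : ∀ (j : ℕ) (x : ℝ), Real.pi < 2 ^ (j + 1) * |x| → |x| ≤ Real.pi → ∀ N : ℕ,
      |∑ n ∈ Finset.range N, (a n * Real.cos (n * x) + b n * Real.sin (n * x))| ≤
        ((2 : ℝ) ^ j) ^ (1 - (1 + γ - 1 / p)) * E j := fun j x hx hx' N => by
    rw [hsum]
    exact (hL _).trans (hbd j x hx hx' N)
  have hae : ∀ᵐ x ∂(volume.restrict (Set.Ioc (-Real.pi) Real.pi)), x ≠ 0 ∧ |x| ≤ Real.pi := by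
    filter_upwards [ae_restrict_mem measurableSet_Ioc,
      ae_restrict_of_ae (Measure.ae_ne volume (0 : ℝ))] with x hx hx0
    exact ⟨hx0, abs_le.2 ⟨hx.1.le, hx.2⟩⟩
  have hF : HasTrigFourierSeries φ a b := by
    refine hasTrigFourierSeries_of_dominated (G := dyadicMajorant (1 + γ - 1 / p) E) (fun x => ?_)
      (integrableOn_dyadicMajorant hp0 hα0 hE hEs) (fun N => ?_) ?_
    · simp only [φ, mul_add, Real.cos_add_nat_mul_two_pi, Real.sin_add_nat_mul_two_pi]
    · filter_upwards [hae] with x ⟨hx, hx'⟩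
      obtain ⟨j, h1, h2⟩ := exists_dyadic_scale (abs_pos.2 hx) hx'
      rw [dyadicMajorant, natLog_floor_eq_of_dyadic_scale h1 h2]
      exact hS j x h1 hx' N
    · filter_upwards [hae] with x ⟨hx, hx'⟩
      exact hconv' x hx hx'
  refine ⟨φ, hF, ?_, hconv⟩
  refine weightedMemLp_of_dyadic_bound hp ?_ hE hEs fun j x hx => ?_
  · refine hF.integrable.aestronglyMeasurable.mono_measure (Measure.restrict_mono ?_ le_rfl)
    intro x hx
    exact ⟨by linarith [hx.1], hx.2.le⟩
  · have hx1 : x ∈ Set.Ioc 0 Real.pi := iUnion_dyadicIoc ▸ Set.mem_iUnion_of_mem j hx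
    have hx2 : |x| = x := abs_of_pos hx1.1
    have hx3 : |x| ≤ Real.pi := hx2.le.trans hx1.2
    rw [mem_dyadicIoc] at hx
    exact le_of_tendsto' (hconv' x hx1.1.ne' hx3).abs
      fun N => hS j x (by rw [hx2]; exact hx.1) hx3 N

end GBV

/-! ### Symmetry and uniqueness for functions with a given series -/

namespace HasTrigFourierSeries

variable {φ ψ : ℝ → ℝ} {a b : ℕ → ℝ}

theorem intervalIntegrable (h : HasTrigFourierSeries φ a b) :
    IntervalIntegrable φ volume (-Real.pi) Real.pi :=
  (intervalIntegrable_iff_integrableOn_Ioc_of_le (by linarith [Real.pi_pos])).2 h.integrable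

theorem integral_eq (h : HasTrigFourierSeries φ a b) :
    ∫ x in (-Real.pi)..Real.pi, φ x = 2 * Real.pi * a 0 := by
  have := Real.pi_pos
  rw [← h.coeff_zero]
  field_simp

theorem integral_cos_eq (h : HasTrigFourierSeries φ a b) {n : ℕ} (hn : 1 ≤ n) :
    ∫ x in (-Real.pi)..Real.pi, φ x * Real.cos (n * x) = Real.pi * a n := by
  have := Real.pi_pos
  rw [← h.coeff_cos n hn]
  field_simp

theorem integral_sin_eq (h : HasTrigFourierSeries φ a b) {n : ℕ} (hn : 1 ≤ n) :
    ∫ x in (-Real.pi)..Real.pi, φ x * Real.sin (n * x) = Real.pi * b n := by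
  have := Real.pi_pos
  rw [← h.coeff_sin n hn]
  field_simp

theorem neg (h : HasTrigFourierSeries φ a b) :
    HasTrigFourierSeries (fun x => -φ x) (fun n => -a n) fun n => -b n where
  periodic := fun x => by simp only [h.periodic x]
  integrable := h.integrable.neg
  coeff_zero := by rw [intervalIntegral.integral_neg, mul_neg, h.coeff_zero]
  coeff_cos n hn := by
    simp only [neg_mul, intervalIntegral.integral_neg, mul_neg, h.coeff_cos n hn]
  coeff_sin n hn := by
    simp only [neg_mul, intervalIntegral.integral_neg, mul_neg, h.coeff_sin n hn]

theorem comp_neg (h : HasTrigFourierSeries φ a b) :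
    HasTrigFourierSeries (fun x => φ (-x)) a fun n => -b n where
  periodic := fun x => by simp only [neg_add, ← sub_eq_add_neg, h.periodic.sub_eq]
  integrable := by
    have := (IntervalIntegrable.iff_comp_neg (by simp)).1 h.intervalIntegrable
    rw [neg_neg] at this
    exact (intervalIntegrable_iff_integrableOn_Ioc_of_le (by linarith [Real.pi_pos])).1 this.symm
  coeff_zero := by rw [intervalIntegral.integral_comp_neg φ, neg_neg, h.coeff_zero]
  coeff_cos n hn := by
    have := intervalIntegral.integral_comp_neg (a := -Real.pi) (b := Real.pi)
      fun x => φ x * Real.cos (n * x)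
    simp only [mul_neg, Real.cos_neg, neg_neg] at this
    rw [this, h.coeff_cos n hn]
  coeff_sin n hn := by
    have := intervalIntegral.integral_comp_neg (a := -Real.pi) (b := Real.pi)
      fun x => φ x * Real.sin (n * x)
    simp only [mul_neg, Real.sin_neg, neg_neg, intervalIntegral.integral_neg] at this
    rw [neg_eq_iff_eq_neg.1 this, mul_neg, h.coeff_sin n hn]

theorem ae_eq (hφ : HasTrigFourierSeries φ a b) (hψ : HasTrigFourierSeries ψ a b) :
    ∀ᵐ x, x ∈ Set.Ioo (-Real.pi) Real.pi → φ x = ψ x := by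
  have hI := hφ.intervalIntegrable
  have hI' := hψ.intervalIntegrable
  have hcos : ∀ n : ℕ, ∫ x in (-Real.pi)..Real.pi, (φ x - ψ x) * Real.cos (n * x) = 0 := by
    intro n
    have hc : ContinuousOn (fun x : ℝ => Real.cos (n * x)) (Set.uIcc (-Real.pi) Real.pi) := by
      fun_prop
    simp only [sub_mul]
    rw [intervalIntegral.integral_sub (hI.mul_continuousOn hc) (hI'.mul_continuousOn hc)]
    rcases Nat.eq_zero_or_pos n with rfl | hn
    · simp [hφ.integral_eq, hψ.integral_eq]
    · rw [hφ.integral_cos_eq hn, hψ.integral_cos_eq hn, sub_self]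
  have hsin : ∀ n : ℕ, ∫ x in (-Real.pi)..Real.pi, (φ x - ψ x) * Real.sin (n * x) = 0 := by
    intro n
    have hc : ContinuousOn (fun x : ℝ => Real.sin (n * x)) (Set.uIcc (-Real.pi) Real.pi) := by
      fun_prop
    simp only [sub_mul]
    rw [intervalIntegral.integral_sub (hI.mul_continuousOn hc) (hI'.mul_continuousOn hc)]
    rcases Nat.eq_zero_or_pos n with rfl | hn
    · simp
    · rw [hφ.integral_sin_eq hn, hψ.integral_sin_eq hn, sub_self]
  filter_upwards [ae_eq_zero_of_trig_moments_eq_zero (hφ.integrable.sub hψ.integrable) hcos hsin]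
    with x hx hmem
  exact sub_eq_zero.1 (hx hmem)

/-- Reflection changes (a, b) into (a, -b), so by uniqueness a cosine series forces φ to be even and
a sine series odd, almost everywhere. -/
theorem ae_abs_comp_neg {c : ℕ → ℝ}
    (hab : (a = c ∧ b = fun _ => 0) ∨ ((a = fun _ => 0) ∧ b = c))
    (h : HasTrigFourierSeries φ a b) :
    ∀ᵐ x, x ∈ Set.Ioo (-Real.pi) Real.pi → |φ (-x)| = |φ x| := by
  rcases hab with ⟨rfl, rfl⟩ | ⟨rfl, rfl⟩
  · have h' := h.comp_neg
    simp only [neg_zero] at h'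
    filter_upwards [h'.ae_eq h] with x hx hmem
    rw [hx hmem]
  · have h' := h.comp_neg.neg
    simp only [neg_zero, neg_neg] at h'
    filter_upwards [h'.ae_eq h] with x hx hmem
    rw [← hx hmem, abs_neg]

/-- Pairing with the exponentials recovers the coefficients of a cosine or sine series, after
taking real or imaginary parts. -/
theorem exists_clm_integral {c : ℕ → ℝ}
    (hab : (a = c ∧ b = fun _ => 0) ∨ ((a = fun _ => 0) ∧ b = c))
    (h : HasTrigFourierSeries φ a b) :
    ∃ L : ℂ →L[ℝ] ℝ, (∀ w, |L w| ≤ ‖w‖) ∧ ∀ n : ℕ, 1 ≤ n →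
      ∫ x in (-Real.pi)..Real.pi, φ x * L (Complex.exp (Complex.I * x) ^ n) = Real.pi * c n := by
  have hexp : ∀ (n : ℕ) (x : ℝ), Complex.exp (Complex.I * x) ^ n =
      Complex.exp (((n * x : ℝ) : ℂ) * Complex.I) := by
    intro n x
    rw [← Complex.exp_nat_mul]
    push_cast
    ring_nf
  rcases hab with ⟨rfl, rfl⟩ | ⟨rfl, rfl⟩
  · refine ⟨Complex.reCLM, Complex.abs_re_le_norm, fun n hn => ?_⟩
    simp only [hexp, Complex.reCLM_apply, Complex.exp_ofReal_mul_I_re]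
    exact h.integral_cos_eq hn
  · refine ⟨Complex.imCLM, Complex.abs_im_le_norm, fun n hn => ?_⟩
    simp only [hexp, Complex.imCLM_apply, Complex.exp_ofReal_mul_I_im]
    exact h.integral_sin_eq hn

end HasTrigFourierSeries

/-! ### From the function to coefficients -/

/-- On the i-th interval x^γ costs 2^(-iγ) and Hölder against 1 costs 2^(-i/q), up to constants. As
γ + 1/q = 1 + γ - 1/p, the weight cancels both, leaving the local L^p norm of x^(-γ) φ. -/
theorem WeightedMemLp.summable_dyadic {p γ : ℝ} (hp : 1 < p) {φ : ℝ → ℝ}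
    (hφ : WeightedMemLp p γ φ) (hint : IntegrableOn φ (Set.Ioc 0 Real.pi)) :
    Summable fun i : ℕ => (((2 : ℝ) ^ i) ^ (1 + γ - 1 / p) * ∫ x in dyadicIoc i, |φ x|) ^ p := by
  have hpi := Real.pi_pos
  have hp0 : 0 < p := by linarith
  have hpq : p.HolderConjugate p.conjExponent := Real.HolderConjugate.conjExponent hp
  set q := p.conjExponent
  have hq0 : 0 < q := hpq.symm.pos
  have hq : 1 / q = 1 - 1 / p := by
    have := hpq.inv_add_inv_eq_one
    rw [one_div, one_div]
    linarith
  have hsub : ∀ i, dyadicIoc i ⊆ Set.Ioc 0 Real.pi := fun i =>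
    iUnion_dyadicIoc ▸ Set.subset_iUnion dyadicIoc i
  set F : ℝ → ℝ := fun x => |x ^ (-γ) * φ x| with hF
  have hFm : MemLp F (ENNReal.ofReal p) (volume.restrict (Set.Ioc 0 Real.pi)) := by
    rw [← restrict_Ioo_eq_restrict_Ioc]
    exact hφ.norm
  have hFp : IntegrableOn (fun x => F x ^ p) (⋃ i, dyadicIoc i) := by
    rw [iUnion_dyadicIoc]
    have := hFm.integrable_norm_rpow (by simpa using hp0) ENNReal.ofReal_ne_top
    rw [ENNReal.toReal_ofReal hp0.le] at this
    simpa only [IntegrableOn, hF, norm_abs_eq_norm, Real.norm_eq_abs] using this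
  have hsum := (hasSum_integral_iUnion measurableSet_dyadicIoc pairwise_disjoint_dyadicIoc
    hFp).summable
  refine Summable.of_nonneg_of_le (fun i => Real.rpow_nonneg (mul_nonneg (by positivity)
    (integral_nonneg fun x => abs_nonneg _)) p) (fun i => ?_)
    (hsum.mul_left ((Real.pi ^ |γ| * Real.pi ^ (1 / q)) ^ p))
  have hFi : MemLp F (ENNReal.ofReal p) (volume.restrict (dyadicIoc i)) :=
    hFm.mono_measure (Measure.restrict_mono (hsub i) le_rfl)
  have : IsFiniteMeasure (volume.restrict (dyadicIoc i)) :=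
    ⟨by rw [Measure.restrict_apply_univ, volume_dyadicIoc]; exact ENNReal.ofReal_lt_top⟩
  have hFint : IntegrableOn F (dyadicIoc i) :=
    hFi.integrable (by simpa using hp.le)
  have hI0 : 0 ≤ ∫ x in dyadicIoc i, F x ^ p :=
    integral_nonneg fun x => Real.rpow_nonneg (abs_nonneg _) p
  have h2i : (0 : ℝ) < 2 ^ i := by positivity
  have holder : ∫ x in dyadicIoc i, F x ≤
      (∫ x in dyadicIoc i, F x ^ p) ^ (1 / p) * (Real.pi ^ (1 / q) * ((2 : ℝ) ^ i) ^ (-(1 / q))) := by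
    have h := integral_mul_le_Lp_mul_Lq_of_nonneg hpq (μ := volume.restrict (dyadicIoc i))
      (f := F) (g := fun _ => 1) (Eventually.of_forall fun x => abs_nonneg _)
      (Eventually.of_forall fun x => zero_le_one) hFi (memLp_const 1)
    simp only [mul_one, Real.one_rpow, integral_const, smul_eq_mul, measureReal_def,
      Measure.restrict_apply_univ, volume_dyadicIoc] at h
    rw [ENNReal.toReal_ofReal (by positivity)] at h
    refine h.trans (mul_le_mul_of_nonneg_left ?_ (by positivity))
    rw [Real.rpow_neg h2i.le, ← div_eq_mul_inv, ← Real.div_rpow hpi.le h2i.le]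
    gcongr
    · exact one_le_two
    · omega
  have hφF : ∫ x in dyadicIoc i, |φ x| ≤
      Real.pi ^ |γ| * ((2 : ℝ) ^ i) ^ (-γ) * ∫ x in dyadicIoc i, F x := by
    rw [← integral_const_mul]
    refine setIntegral_mono_on (hint.mono_set (hsub i)).abs (hFint.const_mul _)
      (measurableSet_dyadicIoc i) fun x hx => ?_
    have hx0 : 0 < x := (hsub i hx).1
    rw [mem_dyadicIoc] at hx
    have h := Real.rpow_le_of_dyadic_scale hx.1 hx.2 γ
    calc |φ x| = x ^ γ * F x := by
          rw [hF]
          simp only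
          rw [abs_mul, abs_of_pos (Real.rpow_pos_of_pos hx0 _), ← mul_assoc,
            ← Real.rpow_add hx0, add_neg_cancel, Real.rpow_zero, one_mul]
      _ ≤ _ := mul_le_mul_of_nonneg_right h (abs_nonneg _)
  have key : ((2 : ℝ) ^ i) ^ (1 + γ - 1 / p) * ∫ x in dyadicIoc i, |φ x| ≤
      Real.pi ^ |γ| * Real.pi ^ (1 / q) * (∫ x in dyadicIoc i, F x ^ p) ^ (1 / p) := by
    calc _ ≤ ((2 : ℝ) ^ i) ^ (1 + γ - 1 / p) * (Real.pi ^ |γ| * ((2 : ℝ) ^ i) ^ (-γ) *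
          ((∫ x in dyadicIoc i, F x ^ p) ^ (1 / p) *
            (Real.pi ^ (1 / q) * ((2 : ℝ) ^ i) ^ (-(1 / q))))) := by
          refine mul_le_mul_of_nonneg_left (hφF.trans ?_) (by positivity)
          exact mul_le_mul_of_nonneg_left holder (by positivity)
      _ = (((2 : ℝ) ^ i) ^ (1 + γ - 1 / p) * ((2 : ℝ) ^ i) ^ (-γ) * ((2 : ℝ) ^ i) ^ (-(1 / q))) *
          (Real.pi ^ |γ| * Real.pi ^ (1 / q) * (∫ x in dyadicIoc i, F x ^ p) ^ (1 / p)) := by ring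
      _ = _ := by
          rw [← Real.rpow_add h2i, ← Real.rpow_add h2i, hq,
            show 1 + γ - 1 / p + -γ + -(1 - 1 / p) = 0 by ring, Real.rpow_zero, one_mul]
  calc _ ≤ (Real.pi ^ |γ| * Real.pi ^ (1 / q) * (∫ x in dyadicIoc i, F x ^ p) ^ (1 / p)) ^ p :=
        Real.rpow_le_rpow (mul_nonneg (by positivity) (integral_nonneg fun x => abs_nonneg _))
          key hp0.le
    _ = _ := by
        rw [Real.mul_rpow (by positivity) (by positivity), ← Real.rpow_mul hI0,
          one_div_mul_cancel hp0.ne', Real.rpow_one]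

/-- The minimum of the trivial bound 2^j and the geometric-sum bound 2/|z - 1| ≤ 2·2^i. -/
theorem norm_sum_exp_pow_le {x : ℝ} {i : ℕ} (hx : Real.pi < 2 ^ (i + 1) * |x|)
    (hx' : |x| ≤ Real.pi) (j : ℕ) :
    ‖∑ k ∈ Finset.range (2 ^ j), Complex.exp (Complex.I * x) ^ k‖ ≤ 2 * 2 ^ min i j := by
  set z := Complex.exp (Complex.I * x)
  have hz1 : ‖z‖ = 1 := norm_exp_I_mul x
  have h1 : ‖∑ k ∈ Finset.range (2 ^ j), z ^ k‖ ≤ 2 ^ j := by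
    refine (norm_sum_le _ _).trans (le_of_eq ?_)
    simp [hz1]
  have h2 : ‖∑ k ∈ Finset.range (2 ^ j), z ^ k‖ ≤ 2 * 2 ^ i := by
    have h3 := one_le_two_pow_mul_norm_exp_sub_one hx hx'
    have h4 : ‖∑ k ∈ Finset.range (2 ^ j), z ^ k‖ * ‖z - 1‖ ≤ 2 := by
      rw [← norm_mul, geom_sum_mul]
      refine (norm_sub_le _ _).trans ?_
      rw [norm_pow, hz1, one_pow, norm_one]
      norm_num
    calc _ ≤ ‖∑ k ∈ Finset.range (2 ^ j), z ^ k‖ * (2 ^ i * ‖z - 1‖) :=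
          le_mul_of_one_le_right (norm_nonneg _) h3
      _ = 2 ^ i * (‖∑ k ∈ Finset.range (2 ^ j), z ^ k‖ * ‖z - 1‖) := by ring
      _ ≤ 2 ^ i * 2 := by gcongr
      _ = _ := mul_comm _ _
  rcases le_total i j with h | h
  · rwa [min_eq_left h]
  · rw [min_eq_right h]
    linarith [pow_pos (two_pos (α := ℝ)) j]

/-- If `|φ|` is essentially even, the integral of `|φ|` against the square of a Dirichlet-type
kernel is controlled by the dyadic integrals of `|φ|`. -/
theorem integral_abs_mul_sq_le {φ : ℝ → ℝ} (hint : IntegrableOn φ (Set.Ioc (-Real.pi) Real.pi))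
    (heven : ∀ᵐ x, x ∈ Set.Ioo (-Real.pi) Real.pi → |φ (-x)| = |φ x|) (j : ℕ) {R : ℝ}
    (hR : ∀ J, ∑ i ∈ Finset.range J, (2 : ℝ) ^ min i j * ∫ x in dyadicIoc i, |φ x| ≤ R) :
    ∫ x in (-Real.pi)..Real.pi, |φ x| *
      ‖∑ k ∈ Finset.range (2 ^ j), Complex.exp (Complex.I * x) ^ k‖ ^ 2 ≤ 8 * 2 ^ j * R := by
  have hpi := Real.pi_pos
  set D : ℝ → ℝ := fun x =>
    ‖∑ k ∈ Finset.range (2 ^ j), Complex.exp (Complex.I * x) ^ k‖ ^ 2 with hD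
  have hDc : Continuous D := by fun_prop
  have hDneg : ∀ x, D (-x) = D x := by
    intro x
    have : ∑ k ∈ Finset.range (2 ^ j), Complex.exp (Complex.I * ((-x : ℝ) : ℂ)) ^ k =
        (starRingEnd ℂ) (∑ k ∈ Finset.range (2 ^ j), Complex.exp (Complex.I * x) ^ k) := by
      rw [map_sum]
      refine Finset.sum_congr rfl fun k _ => ?_
      rw [map_pow, ← Complex.exp_conj, map_mul, Complex.conj_I, Complex.conj_ofReal]
      push_cast
      rw [mul_neg, neg_mul]
    simp only [hD, this, Complex.norm_conj]
  have hII : IntervalIntegrable φ volume (-Real.pi) Real.pi :=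
    (intervalIntegrable_iff_integrableOn_Ioc_of_le (by linarith)).2 hint
  have hf : IntervalIntegrable (fun x => |φ x| * D x) volume (-Real.pi) Real.pi :=
    hII.abs.mul_continuousOn hDc.continuousOn
  have hf1 : IntervalIntegrable (fun x => |φ x| * D x) volume (-Real.pi) 0 :=
    hf.mono_set (Set.uIcc_subset_uIcc_left (by rw [Set.uIcc_of_le] <;> simp <;> linarith))
  have hf2 : IntervalIntegrable (fun x => |φ x| * D x) volume 0 Real.pi :=
    hf.mono_set (Set.uIcc_subset_uIcc_right (by rw [Set.uIcc_of_le] <;> simp <;> linarith))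
  have hhalf : ∫ x in (-Real.pi)..0, |φ x| * D x = ∫ x in (0 : ℝ)..Real.pi, |φ x| * D x := by
    have h1 := intervalIntegral.integral_comp_neg (a := 0) (b := Real.pi) fun x => |φ x| * D x
    rw [neg_zero] at h1
    rw [← h1]
    refine intervalIntegral.integral_congr_ae ?_
    filter_upwards [heven, Measure.ae_ne volume Real.pi] with x hx hne hmem
    rw [Set.uIoc_of_le hpi.le] at hmem
    rw [hDneg, hx ⟨by linarith [hmem.1], lt_of_le_of_ne hmem.2 hne⟩]
  have hfint : IntegrableOn (fun x => |φ x| * D x) (⋃ i, dyadicIoc i) := by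
    rw [iUnion_dyadicIoc]
    exact (intervalIntegrable_iff_integrableOn_Ioc_of_le hpi.le).1 hf2
  have hsub : ∀ i, dyadicIoc i ⊆ Set.Ioc 0 Real.pi := fun i =>
    iUnion_dyadicIoc ▸ Set.subset_iUnion dyadicIoc i
  have hsum := (hasSum_integral_iUnion measurableSet_dyadicIoc pairwise_disjoint_dyadicIoc hfint)
  have hpos : ∫ x in (0 : ℝ)..Real.pi, |φ x| * D x ≤ 4 * 2 ^ j * R := by
    rw [intervalIntegral.integral_of_le hpi.le, ← iUnion_dyadicIoc]
    refine le_of_tendsto' hsum.tendsto_sum_nat fun J => ?_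
    calc ∑ i ∈ Finset.range J, ∫ x in dyadicIoc i, |φ x| * D x
        ≤ ∑ i ∈ Finset.range J, 4 * 2 ^ j * (2 ^ min i j * ∫ x in dyadicIoc i, |φ x|) := by
          refine Finset.sum_le_sum fun i _ => ?_
          have hφi : IntegrableOn (fun x => |φ x|) (dyadicIoc i) :=
            (hint.mono_set ((hsub i).trans (Set.Ioc_subset_Ioc_left (by linarith)))).abs
          rw [← mul_assoc, ← integral_const_mul]
          refine setIntegral_mono_on (hfint.mono_set (Set.subset_iUnion dyadicIoc i))
            (hφi.const_mul _) (measurableSet_dyadicIoc i) fun x hx => ?_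
          obtain ⟨hx0, hxpi⟩ := hsub i hx
          rw [mem_dyadicIoc] at hx
          have hax : |x| = x := abs_of_pos hx0
          have h1 := norm_sum_exp_pow_le (x := x) (by rw [hax]; exact hx.1) (by rwa [hax]) j
          -- Only one factor 2^min(i,j) of the square is kept; the other is replaced by 2^j, which
          -- returns the sum to the kernel of `hR`.
          have h2 : D x ≤ 4 * 2 ^ j * 2 ^ min i j := by
            calc D x ≤ (2 * 2 ^ min i j) ^ 2 := pow_le_pow_left₀ (norm_nonneg _) h1 2
              _ = 4 * 2 ^ min i j * 2 ^ min i j := by ring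
              _ ≤ 4 * 2 ^ j * 2 ^ min i j := by
                  gcongr
                  · exact one_le_two
                  · exact min_le_right i j
          rw [mul_comm]
          exact mul_le_mul_of_nonneg_right h2 (abs_nonneg _)
      _ ≤ _ := by
          rw [← Finset.mul_sum]
          exact mul_le_mul_of_nonneg_left (hR J) (by positivity)
  rw [← intervalIntegral.integral_add_adjacent_intervals hf1 hf2, hhalf]
  linarith

theorem le_sq_mul_of_doubling_variation {c : ℕ → ℝ} {M : ℝ} (hM : 0 < M)
    (hv : ∀ m : ℕ, 1 ≤ m → ∑ n ∈ Finset.Icc m (2 * m), |c n - c (n + 1)| ≤ M * c m)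
    {m n : ℕ} (hm : 1 ≤ m) (hmn : m ≤ n) (hn : n ≤ 4 * m) : c n ≤ (1 + M) ^ 2 * c m := by
  -- Two doublings, through the intermediate index min(2m, n).
  have h1 := le_of_doubling_variation hv hm (n := min (2 * m) n) (by omega) (by omega)
  have h2 := le_of_doubling_variation hv (m := min (2 * m) n) (n := n) (by omega) (by omega)
    (by omega)
  calc c n ≤ (1 + M) * c (min (2 * m) n) := h2
    _ ≤ (1 + M) * ((1 + M) * c m) := by gcongr
    _ = _ := by ring

/-- Multiplication by z^N moves the frequencies of D² to N + k + l, between N and 3N - 2. The index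
4N = 2^(j+2) is beyond all of them and at most four times each, so c(4N) is bounded by (1 + M)²
times every coefficient that occurs. -/
theorem HasTrigFourierSeries.coeff_le {φ : ℝ → ℝ} {a b c : ℕ → ℝ} {M : ℝ} (hM : 0 < M)
    (hv : ∀ m : ℕ, 1 ≤ m → ∑ n ∈ Finset.Icc m (2 * m), |c n - c (n + 1)| ≤ M * c m)
    (hab : (a = c ∧ b = fun _ => 0) ∨ ((a = fun _ => 0) ∧ b = c))
    (h : HasTrigFourierSeries φ a b) (j : ℕ) {R : ℝ}
    (hR : ∀ J, ∑ i ∈ Finset.range J, (2 : ℝ) ^ min i j * ∫ x in dyadicIoc i, |φ x| ≤ R) :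
    2 ^ j * c (2 ^ (j + 2)) ≤ 8 * (1 + M) ^ 2 * R := by
  have hpi := Real.pi_gt_three
  have hle : -Real.pi ≤ Real.pi := by linarith
  obtain ⟨L, hL, hLc⟩ := h.exists_clm_integral hab
  set N := 2 ^ j with hN
  have hN1 : 1 ≤ N := Nat.one_le_two_pow
  have hupper := integral_abs_mul_sq_le h.integrable (h.ae_abs_comp_neg hab) j hR
  have hI := h.intervalIntegrable
  have hLcont : ∀ n : ℕ, Continuous fun x : ℝ => L (Complex.exp (Complex.I * x) ^ n) := fun n => by
    fun_prop
  have hsum : ∫ x in (-Real.pi)..Real.pi, φ x * L (Complex.exp (Complex.I * x) ^ N *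
      (∑ k ∈ Finset.range N, Complex.exp (Complex.I * x) ^ k) ^ 2) =
      ∑ k ∈ Finset.range N, ∑ l ∈ Finset.range N, Real.pi * c (N + k + l) := by
    have e : ∀ x : ℝ, φ x * L (Complex.exp (Complex.I * x) ^ N *
        (∑ k ∈ Finset.range N, Complex.exp (Complex.I * x) ^ k) ^ 2) =
        ∑ k ∈ Finset.range N, ∑ l ∈ Finset.range N,
          φ x * L (Complex.exp (Complex.I * x) ^ (N + k + l)) := by
      intro x
      rw [sq, Finset.sum_mul_sum, Finset.mul_sum, map_sum, Finset.mul_sum]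
      refine Finset.sum_congr rfl fun k _ => ?_
      rw [Finset.mul_sum, map_sum, Finset.mul_sum]
      refine Finset.sum_congr rfl fun l _ => ?_
      rw [pow_add, pow_add, mul_assoc]
    have hi : ∀ n, IntervalIntegrable
        (fun x => φ x * L (Complex.exp (Complex.I * x) ^ n)) volume (-Real.pi) Real.pi := fun n =>
      hI.mul_continuousOn (hLcont n).continuousOn
    simp_rw [e]
    rw [intervalIntegral.integral_finsetSum fun k _ => by
      simpa only [Finset.sum_fn] using
        IntervalIntegrable.sum (Finset.range N) fun l _ => hi (N + k + l)]
    refine Finset.sum_congr rfl fun k _ => ?_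
    rw [intervalIntegral.integral_finsetSum fun l _ => hi _]
    refine Finset.sum_congr rfl fun l _ => ?_
    exact hLc _ (by omega)
  have hlower : (N : ℝ) * N * (Real.pi * c (2 ^ (j + 2))) ≤ (1 + M) ^ 2 *
      ∑ k ∈ Finset.range N, ∑ l ∈ Finset.range N, Real.pi * c (N + k + l) := by
    have : (N : ℝ) * N * (Real.pi * c (2 ^ (j + 2))) =
        ∑ k ∈ Finset.range N, ∑ l ∈ Finset.range N, Real.pi * c (2 ^ (j + 2)) := by
      simp [mul_assoc]
    rw [this, Finset.mul_sum]
    refine Finset.sum_le_sum fun k hk => ?_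
    rw [Finset.mul_sum]
    refine Finset.sum_le_sum fun l hl => ?_
    rw [Finset.mem_range] at hk hl
    have h4 : 2 ^ (j + 2) = 4 * N := by rw [hN, pow_add]; ring
    have := le_sq_mul_of_doubling_variation hM hv (m := N + k + l) (n := 2 ^ (j + 2)) (by omega)
      (by omega) (by omega)
    nlinarith
  have habs : ∫ x in (-Real.pi)..Real.pi, φ x * L (Complex.exp (Complex.I * x) ^ N *
      (∑ k ∈ Finset.range N, Complex.exp (Complex.I * x) ^ k) ^ 2) ≤
      ∫ x in (-Real.pi)..Real.pi, |φ x| *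
        ‖∑ k ∈ Finset.range N, Complex.exp (Complex.I * x) ^ k‖ ^ 2 := by
    refine intervalIntegral.integral_mono_on hle
      (hI.mul_continuousOn (Continuous.continuousOn (by fun_prop)))
      (hI.abs.mul_continuousOn (Continuous.continuousOn (by fun_prop))) fun x _ => ?_
    refine (le_abs_self _).trans ?_
    rw [abs_mul]
    refine mul_le_mul_of_nonneg_left ((hL _).trans (le_of_eq ?_)) (abs_nonneg _)
    rw [norm_mul, norm_pow, norm_exp_I_mul, one_pow, one_mul, norm_pow]
  have hNr : (N : ℝ) = 2 ^ j := by rw [hN]; push_cast; rfl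
  have hR0 : 0 ≤ R := by simpa using hR 0
  have h2j : (0 : ℝ) < 2 ^ j := by positivity
  rw [← hsum, hNr] at hlower
  have hmain : 2 ^ j * (Real.pi * (2 ^ j * c (2 ^ (j + 2)))) ≤ 2 ^ j * (8 * (1 + M) ^ 2 * R) := by
    have := mul_le_mul_of_nonneg_left (habs.trans hupper) (sq_nonneg (1 + M))
    linarith
  have hmain' := le_of_mul_le_mul_left hmain h2j
  have hRM : 0 ≤ 8 * (1 + M) ^ 2 * R := by positivity
  -- The factor π > 1 can be dropped from a nonnegative quantity; a negative one is below the right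
  -- side, as R ≥ 0 by the empty sum.
  by_cases hneg : 0 ≤ 2 ^ j * c (2 ^ (j + 2))
  · nlinarith
  · linarith

theorem HasTrigFourierSeries.summable_dyadic_coeff {φ : ℝ → ℝ} {a b c : ℕ → ℝ} {M : ℝ}
    (h0 : ∀ n : ℕ, 1 ≤ n → 0 ≤ c n) (hM : 0 < M)
    (hv : ∀ m : ℕ, 1 ≤ m → ∑ n ∈ Finset.Icc m (2 * m), |c n - c (n + 1)| ≤ M * c m)
    {p γ : ℝ} (hp : 1 < p) (hγ₁ : 1 / p - 1 < γ) (hγ₂ : γ < 1 / p)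
    (hab : (a = c ∧ b = fun _ => 0) ∨ ((a = fun _ => 0) ∧ b = c))
    (h : HasTrigFourierSeries φ a b) (hφ : WeightedMemLp p γ φ) :
    Summable fun i : ℕ => (((2 : ℝ) ^ i) ^ (1 + γ - 1 / p) * c (2 ^ i)) ^ p := by
  have hp0 : 0 < p := by linarith
  set α := 1 + γ - 1 / p with hα
  have hα0 : 0 < α := by linarith
  have hα1 : α < 1 := by linarith
  have hA : ∀ i : ℕ, 0 ≤ c (2 ^ i) := fun i => h0 _ Nat.one_le_two_pow
  have hg : ∀ i, 0 ≤ ∫ x in dyadicIoc i, |φ x| := fun i => integral_nonneg fun x => abs_nonneg _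
  have hgs := hφ.summable_dyadic hp
    (h.integrable.mono_set (Set.Ioc_subset_Ioc_left (by linarith [Real.pi_pos])))
  have hB : ∀ i : ℕ, 0 ≤ ((2 : ℝ) ^ i) ^ α * ∫ x in dyadicIoc i, |φ x| := fun i =>
    mul_nonneg (by positivity) (hg i)
  have hTs := (summable_geometric_conv (dyadicRatio_pos α).le (dyadicRatio_lt_one hα0 hα1) hp
    hB hgs).2
  set T := dyadicConv α fun i : ℕ => ((2 : ℝ) ^ i) ^ α * ∫ x in dyadicIoc i, |φ x|
  have hTnn : ∀ j, 0 ≤ T j := fun j => dyadicConv_nonneg hB j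
  -- The coefficient estimate at scale j concerns the index 2^(j+2); the shift by two costs the
  -- factor 4^α.
  rw [← summable_nat_add_iff 2]
  refine Summable.of_nonneg_of_le
    (fun j => Real.rpow_nonneg (mul_nonneg (by positivity) (hA _)) p) (fun j => ?_)
    (hTs.mul_left ((4 ^ α * (8 * (1 + M) ^ 2)) ^ p))
  have h1 := h.coeff_le hM hv hab j fun J => sum_two_pow_min_le hα0 hα1 hg hp hgs j J
  have h2j : (0 : ℝ) < 2 ^ j := by positivity
  have key : ((2 : ℝ) ^ (j + 2)) ^ α * c (2 ^ (j + 2)) ≤ 4 ^ α * (8 * (1 + M) ^ 2) * T j := by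
    have e : ((2 : ℝ) ^ (j + 2)) ^ α = 4 ^ α * ((2 : ℝ) ^ j) ^ α := by
      rw [← Real.mul_rpow (by norm_num) h2j.le, pow_add]
      norm_num [mul_comm]
    have e2 : (2 : ℝ) ^ j = ((2 : ℝ) ^ j) ^ α * ((2 : ℝ) ^ j) ^ (1 - α) := by
      rw [← Real.rpow_add h2j, add_sub_cancel, Real.rpow_one]
    have h3 : ((2 : ℝ) ^ j) ^ α * c (2 ^ (j + 2)) ≤ 8 * (1 + M) ^ 2 * T j := by
      refine le_of_mul_le_mul_left ?_ (Real.rpow_pos_of_pos h2j (1 - α))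
      calc _ = ((2 : ℝ) ^ j) ^ α * ((2 : ℝ) ^ j) ^ (1 - α) * c (2 ^ (j + 2)) := by ring
        _ = 2 ^ j * c (2 ^ (j + 2)) := by rw [← e2]
        _ ≤ _ := h1
        _ = _ := by ring
    rw [e, mul_assoc, mul_assoc]
    exact mul_le_mul_of_nonneg_left h3 (by positivity)
  calc _ ≤ (4 ^ α * (8 * (1 + M) ^ 2) * T j) ^ p :=
        Real.rpow_le_rpow (mul_nonneg (by positivity) (hA _)) key hp0.le
    _ = _ := Real.mul_rpow (by positivity) (hTnn j)

/-! ### The equivalence and the convergence statement -/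

theorem theorem1p3 (p γ : ℝ) (hp : 1 < p) (hγ₁ : 1 / p - 1 < γ) (hγ₂ : γ < 1 / p)
    (c : ℕ → ℝ) (hc : GBV c) (a b : ℕ → ℝ)
    -- the series is the cosine series or the sine series with coefficients `c`
    (hab : (a = c ∧ b = fun _ => 0) ∨ ((a = fun _ => 0) ∧ b = c)) :
    (∀ φ : ℝ → ℝ, HasTrigFourierSeries φ a b →
      (WeightedMemLp p γ φ ↔
        Summable fun n : ℕ => ((n + 1 : ℕ) : ℝ) ^ (p + p * γ - 2) * c (n + 1) ^ p)) ∧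
    ((Summable fun n : ℕ => ((n + 1 : ℕ) : ℝ) ^ (p + p * γ - 2) * c (n + 1) ^ p) →
      ∃ φ : ℝ → ℝ, HasTrigFourierSeries φ a b ∧ WeightedMemLp p γ φ ∧
        ∀ x : ℝ, (∀ k : ℤ, x ≠ 2 * Real.pi * k) → TrigSeriesConvergesTo a b x (φ x)) := by
  obtain ⟨h0, hlim, M, hM, hv⟩ := hc
  have hp0 : 0 < p := by linarith
  have hiff : (Summable fun n : ℕ => ((n + 1 : ℕ) : ℝ) ^ (p + p * γ - 2) * c (n + 1) ^ p) ↔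
      Summable fun i : ℕ => (((2 : ℝ) ^ i) ^ (1 + γ - 1 / p) * c (2 ^ i)) ^ p := by
    rw [summable_weighted_iff_dyadic h0 hM hv hp0]
    refine summable_congr fun i => ?_
    rw [Real.mul_rpow (by positivity) (h0 _ Nat.one_le_two_pow), ← Real.rpow_mul (by positivity)]
    congr 2
    field_simp
    ring
  rw [hiff]
  refine ⟨fun φ hφ => ⟨fun h => hφ.summable_dyadic_coeff h0 hM hv hp hγ₁ hγ₂ hab h, fun h => ?_⟩,
    fun h => exists_hasTrigFourierSeries h0 hlim hM hv hp hγ₁ hγ₂ h hab⟩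
  -- The constructed sum ψ has the same Fourier series as the given φ, so the two agree almost
  -- everywhere.
  obtain ⟨ψ, hψ, hψw, -⟩ := exists_hasTrigFourierSeries h0 hlim hM hv hp hγ₁ hγ₂ h hab
  refine (memLp_congr_ae ?_).1 hψw
  filter_upwards [ae_restrict_of_ae (hψ.ae_eq hφ), ae_restrict_mem measurableSet_Ioo] with x hx hmem
  rw [hx ⟨by linarith [hmem.1, Real.pi_pos], hmem.2⟩]
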